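/- **Conventions.** Let $X$ be a metric space, with distance written $|x,y|$. A $(\lambda,k)$-quasi-geodesic segment is a map $\gamma:[0,a]\to X$ with $\lambda^{-1}|t-s|-k\le |\gamma(t),\gamma(s)|\le\lambda|t-s|+k$ for all $t,s\in[0,a]$. Let $\lambda\ge1$, $k\ge0$, $E\ge1$, $C\ge0$, let $\theta:\mathbb R_{\ge0}\to\mathbb R_{\ge0}$ be non-decreasing, and let $\mathcal L$ be a family of $(\lambda,k)$-quasi-geodesic segments in $X$. The space $X$ is $(\lambda,k,E,C,\theta,\mathcal L)$-*coarsely convex* if 1. for all $v,w\in X$ there is $\gamma\in\mathcal L$, $\gamma:[0,a]\to X$, with $\gamma(0)=v$, $\gamma(a)=w$; 2. for all $\gamma,\eta\in\mathcal L$ with domains $[0,a]$, $[0,b]$ and all $t\in[0,a]$, $s\in[0,b]$, $c\in[0,1]$: $|\gamma(ct),\eta(cs)|\le cE|\gamma(t),\eta(s)|+(1-c)E|\gamma(0),\eta(0)|+C$; 3. for all such $\gamma,\eta,t,s$: $|t-s|\le\theta(|\gamma(0),\eta(0)|+|\gamma(t),\eta(s)|)$. Let $\mathcal L^\infty$ be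 the set of maps $\gamma:\mathbb R_{\ge0}\to X$ such that $\gamma(t)=\gamma(\lfloor t\rfloor)$ for all $t$ and such that there are $\gamma_n\in\mathcal L$, $\gamma_n:[0,a_n]\to X$, with $a_n\to\infty$, $\gamma_n(0)=\gamma(0)$ and $\gamma_n(i)\to\gamma(i)$ for every $i\in\mathbb N$. Write $\gamma\sim\eta$ if $\sup_t|\gamma(t),\eta(t)|<\infty$. The *ideal boundary* is $\partial X:=\mathcal L^\infty/{\sim}$. For a base point $O\in X$ let $\mathcal L^\infty_O:=\{\gamma\in\mathcal L^\infty:\gamma(0)=O\}$ and $\partial_OX:=\mathcal L_O^\infty/{\sim}$. If $X$ is proper (closed bounded sets are compact), the inclusion $\mathcal L^\infty_O\subset\mathcal L^\infty$ identifies $\partial_OX$ with $\partial X$. Put $k_1:=\lambda+k$ and $D:=2(1+E)k_1+C$. For $\gamma,\eta$ that are segments in $\mathcal L$ starting at $O$ or rays in $\mathcal L_O^\infty$, let $(\gamma\mid\eta)_O:=\sup\{t\in\operatorname{Dom}\gamma\cap\operatorname{Dom}\eta:|\gamma(t),\eta(t)|\le 2D+2\}\in[0,\infty]$. For $x\in X$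 with $|x,O|>2\lambda\theta(0)+k$ let $\bar{\mathcal L}_O(x)$ be the set of $\gamma\in\mathcal L$ with domain $[0,a]$, $a\ge2\theta(0)$, $\gamma(0)=O$, $\gamma(a)=x$; for $x\in\partial_OX$ let $\bar{\mathcal L}_O(x)$ be the set of $\gamma\in\mathcal L^\infty_O$ in the class $x$. For $x,y\in X\cup\partial_OX$ put $(x\mid y)_O:=0$ if $x$ or $y$ is a point of $X$ at distance at most $2\lambda\theta(0)+k$ from $O$, and otherwise $(x\mid y)_O:=\sup\{(\gamma\mid\eta)_O:\gamma\in\bar{\mathcal L}_O(x),\ \eta\in\bar{\mathcal L}_O(y)\}$. Give $X\cup\partial_OX$ the topology of the uniform structure with basic entourages $$V_n:=\{(x,y)\in(X\cup\partial_OX)^2:(x\mid y)_O>n\}\cup\{(x,y)\in X^2:|x,y|<1/n\},\qquad n\ge1.$$ Let $X$ and $Y$ be proper coarsely convex spaces, each with fixed data $(\lambda,k,E,C,\theta,\mathcal L)$ as above (the data for $Y$ may differ from those for $X$), and with base points $a\in X$, $b\in Y$. A map $f:X\to Y$ is *visual* if it is large scale Lipschitz (there are $A\ge1$, $B\ge0$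 with $|f(x),f(x')|\le A|x,x'|+B$ for all $x,x'\in X$) and, for all sequences $(x_n),(y_n)$ in $X$ with $(x_n\mid y_n)_a\to\infty$, one has $(f(x_n)\mid f(y_n))_b\to\infty$. The map $\partial f:\partial X\to\partial Y$ *induced* by $f$ is given by $\partial f(x):=\lim_{n\to\infty}f(\gamma(n))$, where $\gamma\in\mathcal L_a^\infty$ is any representative of $x$ and the limit is taken in $Y\cup\partial_bY$ and is a point of $\partial_bY=\partial Y$. The map $f$ is *coarsely surjective* if there is $R\ge0$ such that every point of $Y$ is within distance $R$ of $f(X)$. **Proposition.** Let $X$ and $Y$ be proper coarsely convex spaces, and let $f:X\to Y$ be a visual map. If $f$ is coarsely surjective, then the induced map $\partial f:\partial X\to\partial Y$ is well defined (the limits exist in $\partial Y$ and do not depend on the representatives, so that there is exactly one such map) and surjective. -/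

import Mathlib

open scoped NNReal ENNReal Topology

namespace CoarseConvex

/-- A parametrised segment `[0, len] → X`. The underlying function is total for convenience;
only its values on `[0, len]` are ever used. -/
structure Segment (X : Type*) where
  len : ℝ≥0
  path : ℝ≥0 → X

/-- `γ : [0, len] → X` is a `(lam, k)`-quasi-geodesic segment. -/
def Segment.IsQuasiGeodesic {X : Type*} [MetricSpace X] (γ : Segment X) (lam k : ℝ) : Prop :=
  ∀ t s : ℝ≥0, t ≤ γ.len → s ≤ γ.len →
    lam⁻¹ * |(t : ℝ) - s| - k ≤ dist (γ.path t) (γ.path s) ∧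
      dist (γ.path t) (γ.path s) ≤ lam * |(t : ℝ) - s| + k

/-- The data exhibiting a metric space `X` as a
`(lam, k, E, C, theta, segs)`-coarsely convex space; `segs` is the system of good
quasi-geodesic segments. -/
structure CoarselyConvexStructure (X : Type*) [MetricSpace X] where
  lam : ℝ
  k : ℝ
  E : ℝ
  C : ℝ
  theta : ℝ≥0 → ℝ≥0
  segs : Set (Segment X)
  one_le_lam : 1 ≤ lam
  k_nonneg : 0 ≤ k
  one_le_E : 1 ≤ E
  C_nonneg : 0 ≤ C
  theta_mono : Monotone theta
  quasiGeodesic : ∀ γ ∈ segs, γ.IsQuasiGeodesic lam k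
  /-- Any two points are joined by a good quasi-geodesic segment. -/
  connect : ∀ v w : X, ∃ γ ∈ segs, γ.path 0 = v ∧ γ.path γ.len = w
  /-- The coarsely convex inequality. -/
  convex : ∀ γ ∈ segs, ∀ η ∈ segs, ∀ t s c : ℝ≥0, t ≤ γ.len → s ≤ η.len → c ≤ 1 →
    dist (γ.path (c * t)) (η.path (c * s)) ≤
      c * E * dist (γ.path t) (η.path s) + (1 - (c : ℝ)) * E * dist (γ.path 0) (η.path 0) + C
  /-- Regularity of the parametrisations. -/
  param_reg : ∀ γ ∈ segs, ∀ η ∈ segs, ∀ t s : ℝ≥0, t ≤ γ.len → s ≤ η.len →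
    |(t : ℝ) - s| ≤ theta (nndist (γ.path 0) (η.path 0) + nndist (γ.path t) (η.path s))

variable {X : Type*} [MetricSpace X]

namespace CoarselyConvexStructure

/-- `γ : [0, ∞) → X` has an approximate sequence: good segments `σ n` with the same initial
point as `γ`, with lengths tending to infinity, and converging to `γ` pointwise on `ℕ`. -/
def IsApproximatable (𝒳 : CoarselyConvexStructure X) (γ : ℝ≥0 → X) : Prop :=
  ∃ σ : ℕ → Segment X,
    (∀ n, σ n ∈ 𝒳.segs ∧ (σ n).path 0 = γ 0) ∧
    Filter.Tendsto (fun n => (σ n).len) Filter.atTop Filter.atTop ∧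
    ∀ i : ℕ, Filter.Tendsto (fun n => (σ n).path (i : ℝ≥0)) Filter.atTop (𝓝 (γ (i : ℝ≥0)))

/-- The family of rays `L^∞`: approximatable maps, constant on each `[i, i + 1)`. -/
def rays (𝒳 : CoarselyConvexStructure X) : Set (ℝ≥0 → X) :=
  {γ | 𝒳.IsApproximatable γ ∧ ∀ t : ℝ≥0, γ t = γ ((⌊t⌋₊ : ℕ) : ℝ≥0)}

/-- The rays in `L^∞` starting at `O`. -/
def raysAt (𝒳 : CoarselyConvexStructure X) (O : X) : Set (ℝ≥0 → X) :=
  {γ | γ ∈ 𝒳.rays ∧ γ 0 = O}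

end CoarselyConvexStructure

/-- Two maps `[0, ∞) → X` are equivalent if they stay at bounded distance. -/
def RayEquiv (γ η : ℝ≥0 → X) : Prop :=
  ∃ M : ℝ, ∀ t : ℝ≥0, dist (γ t) (η t) ≤ M

theorem rayEquiv_equivalence : Equivalence (RayEquiv (X := X)) where
  refl γ := ⟨0, fun t => by simp⟩
  symm := fun ⟨M, h⟩ => ⟨M, fun t => by rw [dist_comm]; exact h t⟩
  trans := fun ⟨M, h⟩ ⟨N, h'⟩ =>
    ⟨M + N, fun t => (dist_triangle _ _ _).trans (add_le_add (h t) (h' t))⟩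

/-- Equivalence of rays, restricted to a family `R` of rays. -/
def raySetoid (R : Set (ℝ≥0 → X)) : Setoid R where
  r γ η := RayEquiv (γ : ℝ≥0 → X) (η : ℝ≥0 → X)
  iseqv := ⟨fun _ => rayEquiv_equivalence.refl _, fun h => rayEquiv_equivalence.symm h,
    fun h h' => rayEquiv_equivalence.trans h h'⟩

/-- The ideal boundary `∂X`. -/
def Boundary (𝒳 : CoarselyConvexStructure X) : Type _ :=
  Quotient (raySetoid 𝒳.rays)

/-- The ideal boundary `∂_O X` with respect to a base point `O`. -/
def BoundaryAt (𝒳 : CoarselyConvexStructure X) (O : X) : Type _ :=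
  Quotient (raySetoid (𝒳.raysAt O))

/-- The class in `∂X` of a ray. -/
def Boundary.mk (𝒳 : CoarselyConvexStructure X) (γ : 𝒳.rays) : Boundary 𝒳 :=
  Quotient.mk (raySetoid 𝒳.rays) γ

/-- The class in `∂_O X` of a ray starting at `O`. -/
def BoundaryAt.mk (𝒳 : CoarselyConvexStructure X) (O : X) (γ : 𝒳.raysAt O) :
    BoundaryAt 𝒳 O :=
  Quotient.mk (raySetoid (𝒳.raysAt O)) γ

/-- The canonical map `∂_O X → ∂X` induced by the inclusion of `L_O^∞` in `L^∞`. -/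
def BoundaryAt.toBoundary {𝒳 : CoarselyConvexStructure X} {O : X} :
    BoundaryAt 𝒳 O → Boundary 𝒳 :=
  Quotient.lift (fun γ : 𝒳.raysAt O => Boundary.mk 𝒳 ⟨γ.1, γ.2.1⟩)
    (fun _ _ h => Quotient.sound (s := raySetoid 𝒳.rays) h)

/-- A curve in `X`: a domain in `[0, ∞)` and a map, whose values outside the domain are
irrelevant. It serves to treat segments and rays uniformly. -/
structure Curve (X : Type*) where
  dom : Set ℝ≥0
  path : ℝ≥0 → X

/-- A segment as a curve with domain `[0, len]`. -/
def Segment.toCurve {X : Type*} (γ : Segment X) : Curve X := ⟨{t | t ≤ γ.len}, γ.path⟩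

/-- A ray as a curve with domain `[0, ∞)`. -/
def Curve.ofRay {X : Type*} (γ : ℝ≥0 → X) : Curve X := ⟨Set.univ, γ⟩

/-- The set `X ∪ ∂_O X`. -/
inductive Bordification (𝒳 : CoarselyConvexStructure X) (O : X) : Type _
  | pt (x : X) : Bordification 𝒳 O
  | bd (ξ : BoundaryAt 𝒳 O) : Bordification 𝒳 O

namespace CoarselyConvexStructure

/-- The constant `k₁ = lam + k`. -/
def k₁ (𝒳 : CoarselyConvexStructure X) : ℝ := 𝒳.lam + 𝒳.k

/-- The constant `D = 2 (1 + E) k₁ + C`. -/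
def D (𝒳 : CoarselyConvexStructure X) : ℝ := 2 * (1 + 𝒳.E) * 𝒳.k₁ + 𝒳.C

/-- The product of two curves:
`sup {t ∈ Dom γ ∩ Dom η : d(γ(t), η(t)) ≤ 2 D + 2}`, in `[0, ∞]`. -/
noncomputable def curveProd (𝒳 : CoarselyConvexStructure X) (γ η : Curve X) : ℝ≥0∞ :=
  ⨆ t ∈ {t : ℝ≥0 | t ∈ γ.dom ∩ η.dom ∧ dist (γ.path t) (η.path t) ≤ 2 * 𝒳.D + 2}, (t : ℝ≥0∞)

/-- The good segments of length at least `2 theta(0)` starting at `O`. -/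
def segsAt (𝒳 : CoarselyConvexStructure X) (O : X) : Set (Segment X) :=
  {γ | γ ∈ 𝒳.segs ∧ 2 * 𝒳.theta 0 ≤ γ.len ∧ γ.path 0 = O}

/-- The curves representing a point of `X ∪ ∂_O X`: for `x` in `X`, the segments in
`segsAt O` that end at `x`; for `ξ` in `∂_O X`, the rays in the class `ξ`. -/
def reps (𝒳 : CoarselyConvexStructure X) (O : X) : Bordification 𝒳 O → Set (Curve X)
  | .pt x => {c | ∃ γ ∈ 𝒳.segsAt O, γ.path γ.len = x ∧ c = γ.toCurve}
  | .bd ξ => {c | ∃ γ : 𝒳.raysAt O, BoundaryAt.mk 𝒳 O γ = ξ ∧ c = Curve.ofRay γ.1}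

/-- The points of `X ∪ ∂_O X` that lie in the closed ball in `X` with centre `O` and radius
`2 lam theta(0) + k`. -/
def IsInner (𝒳 : CoarselyConvexStructure X) (O : X) : Bordification 𝒳 O → Prop
  | .pt x => dist x O ≤ 2 * 𝒳.lam * 𝒳.theta 0 + 𝒳.k
  | .bd _ => False

open Classical in
/-- The (generalised Gromov) product `(p | q)_O` on `X ∪ ∂_O X`. -/
noncomputable def gromovProd (𝒳 : CoarselyConvexStructure X) (O : X)
    (p q : Bordification 𝒳 O) : ℝ≥0∞ :=
  if 𝒳.IsInner O p ∨ 𝒳.IsInner O q then 0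
  else ⨆ γ ∈ 𝒳.reps O p, ⨆ η ∈ 𝒳.reps O q, 𝒳.curveProd γ η

/-- The basic entourage `V_n` of `X ∪ ∂_O X`, used for `n ≥ 1`:
`{(p, q) : (p | q)_O > n} ∪ {(x, y) ∈ X × X : d(x, y) < 1 / n}`. -/
def entourage (𝒳 : CoarselyConvexStructure X) (O : X) (n : ℕ) :
    Set (Bordification 𝒳 O × Bordification 𝒳 O) :=
  {pq | (n : ℝ≥0∞) < 𝒳.gromovProd O pq.1 pq.2} ∪
    {pq | ∃ x y : X, pq = (Bordification.pt x, Bordification.pt y) ∧ dist x y < (n : ℝ)⁻¹}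

theorem entourage_anti (𝒳 : CoarselyConvexStructure X) (O : X) {m n : ℕ} (hm : 1 ≤ m)
    (h : m ≤ n) : 𝒳.entourage O n ⊆ 𝒳.entourage O m := by
  rintro pq (hpq | ⟨x, y, rfl, hxy⟩)
  · have hmn : (m : ℝ≥0∞) ≤ n := by exact_mod_cast h
    exact Or.inl (lt_of_le_of_lt (b := (n : ℝ≥0∞)) hmn hpq : (m : ℝ≥0∞) < _)
  · refine Or.inr ⟨x, y, rfl, hxy.trans_le ?_⟩
    have : (0 : ℝ) < m := by exact_mod_cast hm
    gcongr

end CoarselyConvexStructure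

/-- The topology of `X ∪ ∂_O X` given by the uniform structure with entourages `V_n`:
a set `U` is open if for each `p ∈ U` some `V_n(p) = {q : (p, q) ∈ V_n}` is contained in `U`. -/
instance (𝒳 : CoarselyConvexStructure X) (O : X) : TopologicalSpace (Bordification 𝒳 O) where
  IsOpen U := ∀ p ∈ U, ∃ n : ℕ, 1 ≤ n ∧ ∀ q, (p, q) ∈ 𝒳.entourage O n → q ∈ U
  isOpen_univ := fun _ _ => ⟨1, le_rfl, fun _ _ => trivial⟩
  isOpen_inter := by
    rintro U V hU hV p ⟨hpU, hpV⟩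
    obtain ⟨m, hm, hm'⟩ := hU p hpU
    obtain ⟨n, hn, hn'⟩ := hV p hpV
    exact ⟨max m n, le_max_of_le_left hm, fun q hq =>
      ⟨hm' q (𝒳.entourage_anti O hm (le_max_left m n) hq),
        hn' q (𝒳.entourage_anti O hn (le_max_right m n) hq)⟩⟩
  isOpen_sUnion := by
    rintro S hS p ⟨U, hU, hp⟩
    obtain ⟨n, hn, hn'⟩ := hS U hU p hp
    exact ⟨n, hn, fun q hq => ⟨U, hU, hn' q hq⟩⟩

variable {Y : Type*} [MetricSpace Y]

/-- Large scale Lipschitz maps. -/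
def LargeScaleLipschitz (f : X → Y) : Prop :=
  ∃ A B : ℝ, 1 ≤ A ∧ 0 ≤ B ∧ ∀ x x' : X, dist (f x) (f x') ≤ A * dist x x' + B

/-- Coarsely surjective maps: some neighbourhood of `f(X)` of finite radius is all of `Y`. -/
def CoarselySurjective (f : X → Y) : Prop :=
  ∃ R : ℝ, 0 ≤ R ∧ ∀ y : Y, ∃ x : X, dist y (f x) ≤ R

/-- Visual maps, with respect to systems of good quasi-geodesic segments on `X` and `Y` and
base points `a` and `b`. -/
def IsVisual (𝒳 : CoarselyConvexStructure X) (𝒴 : CoarselyConvexStructure Y) (a : X) (b : Y)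
    (f : X → Y) : Prop :=
  LargeScaleLipschitz f ∧
  ∀ x y : ℕ → X,
    Filter.Tendsto (fun n => 𝒳.gromovProd a (.pt (x n)) (.pt (y n))) Filter.atTop (𝓝 ⊤) →
    Filter.Tendsto (fun n => 𝒴.gromovProd b (.pt (f (x n))) (.pt (f (y n)))) Filter.atTop (𝓝 ⊤)

/-- `F : ∂X → ∂Y` is the map induced by `f`: whenever a ray `γ` starting at `a` represents `x`,
the sequence `f(γ(n))` converges in `Y ∪ ∂_b Y` to a point of `∂_b Y` which corresponds to `F x`
under the canonical map `∂_b Y → ∂Y`. -/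
def IsInducedBoundaryMap (𝒳 : CoarselyConvexStructure X) (𝒴 : CoarselyConvexStructure Y)
    (a : X) (b : Y) (f : X → Y) (F : Boundary 𝒳 → Boundary 𝒴) : Prop :=
  ∀ (x : Boundary 𝒳) (γ : 𝒳.raysAt a), (BoundaryAt.mk 𝒳 a γ).toBoundary = x →
    ∃ y : BoundaryAt 𝒴 b,
      Filter.Tendsto (fun n : ℕ => (Bordification.pt (f (γ.1 (n : ℝ≥0))) : Bordification 𝒴 b))
        Filter.atTop (𝓝 (Bordification.bd y)) ∧
      y.toBoundary = F x

end CoarseConvex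

/-! Segments and rays are treated together as good curves. On bounded sets a good curve is `k₁ +
ε`-close to a good segment, so the axioms pass to good curves with worse constants; `D` is exactly
the additive constant of the resulting convexity inequality (`IsGood.convex`). The central estimate
is `exists_min_le_curveProd`: if two good curves from one point are `M`-close at times `t` and `s`,
shrinking time by a constant factor brings their distance below the threshold `2 D + 2`, so their
product is at least a fixed fraction of `min t s`.

Hence the product on `X ∪ ∂_O X` depends on representatives only up to an affine distortion and
satisfies a quasi-ultrametric inequality (`exists_min_gromovProd_le`). Affine distortion is harmless
for divergence, so "the products tend to infinity" is a symmetric and transitive relation between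
sequences. The same estimates show that the sets `V_n` behave as entourages, so convergence to a
boundary point means divergence of products (`tendsto_nhds_bd_iff`), and such limits are unique.

Well-definedness: for a ray `γ`, the points `γ n` converge to its class, so by visuality the
sequence `f (γ n)` has diverging self-products and leaves every bounded set. Properness gives a
subsequential boundary limit, and visuality applied to `γ n` and `γ (φ n)` makes it the limit of the
whole sequence. Transitivity gives independence of the representative.

Surjectivity: given a ray `η` in `Y`, coarse surjectivity gives points `x n` with `f (x n)` at
bounded distance from `η n`. The large scale Lipschitz bound forces `x n` to infinity, so a
subsequence converges to the class of some ray `γ`. By visuality `f (γ n)` has the same limit as `f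
(x (φ n))`, namely the class of `η`. -/

namespace CoarseConvex

variable {X : Type*} [MetricSpace X]

namespace CoarselyConvexStructure

variable {𝒳 : CoarselyConvexStructure X}

/-! ### Coarse geometry of good curves -/

/-- A good curve: a good segment or a ray in `L^∞`. -/
def IsGood (𝒳 : CoarselyConvexStructure X) (c : Curve X) : Prop :=
  (∃ σ ∈ 𝒳.segs, c = σ.toCurve) ∨ ∃ γ ∈ 𝒳.rays, c = Curve.ofRay γ

theorem lam_pos (𝒳 : CoarselyConvexStructure X) : 0 < 𝒳.lam :=
  zero_lt_one.trans_le 𝒳.one_le_lam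

theorem E_pos (𝒳 : CoarselyConvexStructure X) : 0 < 𝒳.E :=
  zero_lt_one.trans_le 𝒳.one_le_E

theorem k₁_pos (𝒳 : CoarselyConvexStructure X) : 0 < 𝒳.k₁ :=
  add_pos_of_pos_of_nonneg 𝒳.lam_pos 𝒳.k_nonneg

theorem D_nonneg (𝒳 : CoarselyConvexStructure X) : 0 ≤ 𝒳.D := by
  have h₁ := 𝒳.k₁_pos
  have h₂ := 𝒳.E_pos
  have h₃ := 𝒳.C_nonneg
  unfold D
  positivity

theorem IsGood.mem_of_le {c : Curve X} (hc : 𝒳.IsGood c) {t u : ℝ≥0} (ht : t ∈ c.dom)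
    (hu : u ≤ t) : u ∈ c.dom := by
  rcases hc with ⟨σ, -, rfl⟩ | ⟨γ, -, rfl⟩
  · exact le_trans hu ht
  · trivial

/-- Good curves are uniformly close to good segments on bounded sets. -/
theorem IsGood.exists_segment {c : Curve X} (hc : 𝒳.IsGood c) (T : ℝ≥0) {ε : ℝ} (hε : 0 < ε) :
    ∃ σ ∈ 𝒳.segs, σ.path 0 = c.path 0 ∧
      ∀ t ∈ c.dom, t ≤ T → t ≤ σ.len ∧ dist (c.path t) (σ.path t) ≤ 𝒳.k₁ + ε := by
  rcases hc with ⟨σ, hσ, rfl⟩ | ⟨γ, ⟨⟨σ, hσ, hlen, hlim⟩, hfloor⟩, rfl⟩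
  · refine ⟨σ, hσ, rfl, fun t ht _ => ⟨ht, ?_⟩⟩
    have := 𝒳.k₁_pos
    simp only [Segment.toCurve, dist_self]
    positivity
  -- Only finitely many integer times up to `T` matter, so one approximating segment is `ε`-close at
  -- all of them; passing from `⌊t⌋₊` to `t` along the segment costs at most `lam + k = k₁`.
  · have h₁ : ∀ᶠ n in Filter.atTop, T ≤ (σ n).len := hlen.eventually_ge_atTop T
    have h₂ : ∀ᶠ n in Filter.atTop, ∀ i ∈ Finset.range (⌊T⌋₊ + 1),
        dist ((σ n).path (i : ℝ≥0)) (γ (i : ℝ≥0)) < ε :=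
      (Filter.eventually_all_finset _).2 fun i _ => Metric.tendsto_nhds.1 (hlim i) ε hε
    obtain ⟨n, hn₁, hn₂⟩ := (h₁.and h₂).exists
    refine ⟨σ n, (hσ n).1, (hσ n).2, fun t _ htT => ⟨htT.trans hn₁, ?_⟩⟩
    have hle : ((⌊t⌋₊ : ℕ) : ℝ≥0) ≤ t := Nat.floor_le zero_le
    have hlt : t < (⌊t⌋₊ : ℕ) + 1 := Nat.lt_floor_add_one t
    have hle' : (((⌊t⌋₊ : ℕ) : ℝ≥0) : ℝ) ≤ t := by exact_mod_cast hle
    have hlt' : (t : ℝ) < (((⌊t⌋₊ : ℕ) : ℝ≥0) : ℝ) + 1 := by exact_mod_cast hlt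
    have hclose := hn₂ ⌊t⌋₊ (Finset.mem_range.2 (Nat.lt_succ_of_le (Nat.floor_mono htT)))
    have hqg := (𝒳.quasiGeodesic _ (hσ n).1 ((⌊t⌋₊ : ℕ) : ℝ≥0) t (hle.trans (htT.trans hn₁))
      (htT.trans hn₁)).2
    have habs : |((((⌊t⌋₊ : ℕ) : ℝ≥0) : ℝ)) - t| ≤ 1 := abs_le.2 ⟨by linarith, by linarith⟩
    have hmul := mul_le_mul_of_nonneg_left habs 𝒳.lam_pos.le
    calc dist (γ t) ((σ n).path t)
        = dist (γ ((⌊t⌋₊ : ℕ) : ℝ≥0)) ((σ n).path t) := by rw [hfloor t]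
      _ ≤ dist (γ ((⌊t⌋₊ : ℕ) : ℝ≥0)) ((σ n).path ((⌊t⌋₊ : ℕ) : ℝ≥0)) +
          dist ((σ n).path ((⌊t⌋₊ : ℕ) : ℝ≥0)) ((σ n).path t) := dist_triangle _ _ _
      _ ≤ 𝒳.k₁ + ε := by
          rw [dist_comm (γ _)]
          unfold k₁
          linarith

/-- The additive quasi-geodesic constant valid for all good curves. -/
def slack (𝒳 : CoarselyConvexStructure X) : ℝ := 𝒳.k + 2 * 𝒳.k₁ + 2

theorem IsGood.quasiGeodesic {c : Curve X} (hc : 𝒳.IsGood c) {t s : ℝ≥0} (ht : t ∈ c.dom)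
    (hs : s ∈ c.dom) :
    𝒳.lam⁻¹ * |(t : ℝ) - s| - 𝒳.slack ≤ dist (c.path t) (c.path s) ∧
      dist (c.path t) (c.path s) ≤ 𝒳.lam * |(t : ℝ) - s| + 𝒳.slack := by
  obtain ⟨σ, hσ, -, h⟩ := hc.exists_segment (max t s) one_pos
  obtain ⟨ht₁, ht₂⟩ := h t ht (le_max_left _ _)
  obtain ⟨hs₁, hs₂⟩ := h s hs (le_max_right _ _)
  have hq := 𝒳.quasiGeodesic σ hσ t s ht₁ hs₁
  have h₁ := dist_triangle4 (c.path t) (σ.path t) (σ.path s) (c.path s)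
  have h₂ := dist_triangle4 (σ.path t) (c.path t) (c.path s) (σ.path s)
  rw [dist_comm (σ.path s)] at h₁
  rw [dist_comm (σ.path t) (c.path t)] at h₂
  unfold slack
  constructor <;> linarith

/-- The coarsely convex inequality for good curves. -/
theorem IsGood.convex {c c' : Curve X} (hc : 𝒳.IsGood c) (hc' : 𝒳.IsGood c') {t s r : ℝ≥0}
    (ht : t ∈ c.dom) (hs : s ∈ c'.dom) (hr : r ≤ 1) :
    dist (c.path (r * t)) (c'.path (r * s)) ≤ r * 𝒳.E * dist (c.path t) (c'.path s) +
      (1 - (r : ℝ)) * 𝒳.E * dist (c.path 0) (c'.path 0) + 𝒳.D := by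
  refine le_of_forall_pos_le_add fun ε hε => ?_
  have hE := 𝒳.E_pos
  -- Four points are moved by `k₁ + δ`, two of them with weight at most `E`; the total error `2 (1 +
  -- E) (k₁ + δ) + C` is `D + ε`.
  obtain ⟨δ, hδ, hδε⟩ : ∃ δ : ℝ, 0 < δ ∧ 2 * (1 + 𝒳.E) * δ = ε :=
    ⟨ε / (2 * (1 + 𝒳.E)), by positivity, by field_simp⟩
  have hrt : r * t ≤ t := mul_le_of_le_one_left zero_le hr
  have hrs : r * s ≤ s := mul_le_of_le_one_left zero_le hr
  obtain ⟨σ, hσ, hσ₀, h⟩ := hc.exists_segment t hδ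
  obtain ⟨σ', hσ', hσ'₀, h'⟩ := hc'.exists_segment s hδ
  obtain ⟨ht₁, ht₂⟩ := h t ht le_rfl
  obtain ⟨hs₁, hs₂⟩ := h' s hs le_rfl
  obtain ⟨-, ht₃⟩ := h _ (hc.mem_of_le ht hrt) hrt
  obtain ⟨-, hs₃⟩ := h' _ (hc'.mem_of_le hs hrs) hrs
  have hconv := 𝒳.convex σ hσ σ' hσ' t s r ht₁ hs₁ hr
  rw [hσ₀, hσ'₀] at hconv
  have h₁ := dist_triangle4 (c.path (r * t)) (σ.path (r * t)) (σ'.path (r * s)) (c'.path (r * s))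
  have h₂ := dist_triangle4 (σ.path t) (c.path t) (c'.path s) (σ'.path s)
  rw [dist_comm (σ'.path _)] at h₁
  rw [dist_comm (σ.path t) (c.path t)] at h₂
  have hr' : (r : ℝ) ≤ 1 := by exact_mod_cast hr
  have hr₀ : 0 ≤ (r : ℝ) := r.2
  have hk := 𝒳.k₁_pos
  have h₃ : (r : ℝ) * 𝒳.E * dist (σ.path t) (σ'.path s) ≤
      r * 𝒳.E * dist (c.path t) (c'.path s) + 𝒳.E * (2 * (𝒳.k₁ + δ)) := by
    calc (r : ℝ) * 𝒳.E * dist (σ.path t) (σ'.path s)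
        ≤ r * 𝒳.E * (dist (c.path t) (c'.path s) + 2 * (𝒳.k₁ + δ)) := by
          gcongr
          linarith
      _ = r * 𝒳.E * dist (c.path t) (c'.path s) + r * (𝒳.E * (2 * (𝒳.k₁ + δ))) := by ring
      _ ≤ _ := by
          have := mul_le_of_le_one_left (by positivity : 0 ≤ 𝒳.E * (2 * (𝒳.k₁ + δ))) hr'
          linarith
  rw [← hδε]
  unfold D
  linarith

/-- A bound for `|t - s|` when the initial points and the points at `t` and `s` of two good
curves have distances with sum at most `M`. -/
noncomputable def paramBound (𝒳 : CoarselyConvexStructure X) (M : ℝ) : ℝ :=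
  𝒳.theta (M + 2 * 𝒳.k₁ + 2).toNNReal

theorem paramBound_nonneg (𝒳 : CoarselyConvexStructure X) (M : ℝ) : 0 ≤ 𝒳.paramBound M :=
  NNReal.coe_nonneg _

theorem IsGood.param_reg {c c' : Curve X} (hc : 𝒳.IsGood c) (hc' : 𝒳.IsGood c') {t s : ℝ≥0}
    (ht : t ∈ c.dom) (hs : s ∈ c'.dom) {M : ℝ}
    (hM : dist (c.path 0) (c'.path 0) + dist (c.path t) (c'.path s) ≤ M) :
    |(t : ℝ) - s| ≤ 𝒳.paramBound M := by
  obtain ⟨σ, hσ, hσ₀, h⟩ := hc.exists_segment t one_pos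
  obtain ⟨σ', hσ', hσ'₀, h'⟩ := hc'.exists_segment s one_pos
  obtain ⟨ht₁, ht₂⟩ := h t ht le_rfl
  obtain ⟨hs₁, hs₂⟩ := h' s hs le_rfl
  -- Each of the two points moves by at most `k₁ + 1`, which accounts for `2 k₁ + 2` in
  -- `paramBound`.
  refine (𝒳.param_reg σ hσ σ' hσ' t s ht₁ hs₁).trans (NNReal.coe_le_coe.2 (𝒳.theta_mono ?_))
  apply NNReal.le_toNNReal_of_coe_le
  have h₂ := dist_triangle4 (σ.path t) (c.path t) (c'.path s) (σ'.path s)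
  rw [dist_comm (σ.path t) (c.path t)] at h₂
  push_cast
  rw [hσ₀, hσ'₀]
  linarith

/-- A bound for the distance at the smaller of two times of points that are `M`-close, for
curves with `M₀`-close initial points. -/
noncomputable def spread (𝒳 : CoarselyConvexStructure X) (M₀ M : ℝ) : ℝ :=
  M + 𝒳.lam * 𝒳.paramBound (M₀ + M) + 𝒳.slack

/-- The times differ by at most `paramBound (M₀ + M)`, so moving the later point back to the earlier
time costs a bounded amount. This permits comparison at a common time. -/
theorem IsGood.dist_min_le {c c' : Curve X} (hc : 𝒳.IsGood c) (hc' : 𝒳.IsGood c') {t s : ℝ≥0}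
    (ht : t ∈ c.dom) (hs : s ∈ c'.dom) {M₀ M : ℝ} (h₀ : dist (c.path 0) (c'.path 0) ≤ M₀)
    (h : dist (c.path t) (c'.path s) ≤ M) :
    dist (c.path (min t s)) (c'.path (min t s)) ≤ 𝒳.spread M₀ M := by
  have hreg := hc.param_reg hc' ht hs (add_le_add h₀ h)
  have hmul := mul_le_mul_of_nonneg_left hreg 𝒳.lam_pos.le
  unfold spread
  rcases le_total t s with hts | hst
  · rw [min_eq_left hts]
    have h₁ := (hc'.quasiGeodesic (hc'.mem_of_le hs hts) hs).2
    have h₂ := dist_triangle (c.path t) (c'.path s) (c'.path t)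
    rw [dist_comm (c'.path s)] at h₂
    linarith
  · rw [min_eq_right hst]
    have h₁ := (hc.quasiGeodesic ht (hc.mem_of_le ht hst)).2
    have h₂ := dist_triangle (c.path s) (c.path t) (c'.path s)
    rw [dist_comm (c.path s) (c.path t)] at h₂
    linarith

/-- Good curves that are close at some time are close at all earlier times. -/
theorem IsGood.dist_le_of_le {c c' : Curve X} (hc : 𝒳.IsGood c) (hc' : 𝒳.IsGood c')
    {t u : ℝ≥0} (ht : t ∈ c.dom) (ht' : t ∈ c'.dom) (hu : u ≤ t) {M₀ M : ℝ}
    (h₀ : dist (c.path 0) (c'.path 0) ≤ M₀) (h : dist (c.path t) (c'.path t) ≤ M) :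
    dist (c.path u) (c'.path u) ≤ 𝒳.E * M + 𝒳.E * M₀ + 𝒳.D := by
  obtain ⟨r, hr, rfl⟩ : ∃ r ≤ (1 : ℝ≥0), r * t = u := by
    rcases eq_or_ne t 0 with rfl | ht₀
    · exact ⟨1, le_rfl, by simpa using hu.antisymm' zero_le⟩
    · exact ⟨u / t, div_le_one_of_le₀ hu zero_le, div_mul_cancel₀ _ ht₀⟩
  have hconv := hc.convex hc' ht ht' hr
  have hr' : (r : ℝ) ≤ 1 := by exact_mod_cast hr
  have hr₀ : 0 ≤ (r : ℝ) := r.2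
  have hE := 𝒳.E_pos
  have h₁ : (r : ℝ) * 𝒳.E * dist (c.path t) (c'.path t) ≤ 1 * 𝒳.E * M := by gcongr
  have h₂ : (1 - (r : ℝ)) * 𝒳.E * dist (c.path 0) (c'.path 0) ≤ 1 * 𝒳.E * M₀ := by
    gcongr
    linarith
  linarith

/-! ### Products of curves -/

/-- If two good curves with the same initial point are `M`-close at some times, then their
product is at least a fixed fraction of the smaller time. -/
theorem exists_min_le_curveProd (𝒳 : CoarselyConvexStructure X) (M : ℝ) :
    ∃ K : ℝ≥0, 1 ≤ K ∧ ∀ c c' : Curve X, 𝒳.IsGood c → 𝒳.IsGood c' → c.path 0 = c'.path 0 →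
      ∀ t ∈ c.dom, ∀ s ∈ c'.dom, dist (c.path t) (c'.path s) ≤ M →
        ((min t s : ℝ≥0) : ℝ≥0∞) ≤ K * 𝒳.curveProd c c' := by
  have hE := 𝒳.E_pos
  have hN : 0 ≤ 𝒳.E * |𝒳.spread 0 M| := by positivity
  -- Contracting by `K⁻¹` reduces the convexity term `E * spread` to at most `1`, so the distance is
  -- at most `1 + D ≤ 2 D + 2`. The absolute value covers negative `M`.
  refine ⟨1 + (𝒳.E * |𝒳.spread 0 M|).toNNReal, le_self_add, ?_⟩
  intro c c' hc hc' h₀ t ht s hs h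
  set K : ℝ≥0 := 1 + (𝒳.E * |𝒳.spread 0 M|).toNNReal with hK
  have hKpos : 0 < K := by positivity
  have hKinv : K⁻¹ ≤ 1 := inv_le_one_of_one_le₀ le_self_add
  have hKE : 𝒳.E * 𝒳.spread 0 M ≤ K := by
    have h₁ : 𝒳.E * 𝒳.spread 0 M ≤ 𝒳.E * |𝒳.spread 0 M| := by
      gcongr
      exact le_abs_self _
    rw [hK]
    push_cast
    rw [Real.coe_toNNReal _ hN]
    linarith
  have hu := hc.mem_of_le ht (min_le_left t s)
  have hu' := hc'.mem_of_le hs (min_le_right t s)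
  have hmin := hc.dist_min_le hc' ht hs (M₀ := 0) (by simp [h₀]) h
  have hconv := hc.convex hc' hu hu' hKinv
  rw [h₀, dist_self, mul_zero, add_zero] at hconv
  have hone : ((K⁻¹ : ℝ≥0) : ℝ) * 𝒳.E * dist (c.path (min t s)) (c'.path (min t s)) ≤ 1 := by
    calc ((K⁻¹ : ℝ≥0) : ℝ) * 𝒳.E * dist (c.path (min t s)) (c'.path (min t s))
        ≤ ((K⁻¹ : ℝ≥0) : ℝ) * 𝒳.E * 𝒳.spread 0 M := by gcongr
      _ = ((K⁻¹ : ℝ≥0) : ℝ) * (𝒳.E * 𝒳.spread 0 M) := by ring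
      _ ≤ ((K⁻¹ : ℝ≥0) : ℝ) * K := by gcongr
      _ = 1 := by
          push_cast
          exact inv_mul_cancel₀ (by positivity)
  have hle : K⁻¹ * min t s ≤ min t s := mul_le_of_le_one_left zero_le hKinv
  have hD := 𝒳.D_nonneg
  have hmem : ((K⁻¹ * min t s : ℝ≥0) : ℝ≥0∞) ≤ 𝒳.curveProd c c' :=
    le_iSup₂ (f := fun (t : ℝ≥0) (_ : t ∈ {t : ℝ≥0 | t ∈ c.dom ∩ c'.dom ∧
      dist (c.path t) (c'.path t) ≤ 2 * 𝒳.D + 2}) => (t : ℝ≥0∞)) (K⁻¹ * min t s)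
      ⟨⟨hc.mem_of_le hu hle, hc'.mem_of_le hu' hle⟩, by linarith⟩
  calc ((min t s : ℝ≥0) : ℝ≥0∞) = K * ((K⁻¹ * min t s : ℝ≥0) : ℝ≥0∞) := by
        rw [← ENNReal.coe_mul, mul_inv_cancel_left₀ hKpos.ne']
    _ ≤ K * 𝒳.curveProd c c' := by gcongr

theorem exists_of_lt_curveProd {c c' : Curve X} {x : ℝ≥0∞} (h : x < 𝒳.curveProd c c') :
    ∃ t : ℝ≥0, t ∈ c.dom ∧ t ∈ c'.dom ∧ dist (c.path t) (c'.path t) ≤ 2 * 𝒳.D + 2 ∧ x < t := by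
  simp only [curveProd, lt_iSup_iff] at h
  obtain ⟨t, ⟨⟨h₁, h₂⟩, h₃⟩, h₄⟩ := h
  exact ⟨t, h₁, h₂, h₃, h₄⟩

theorem curveProd_comm (𝒳 : CoarselyConvexStructure X) (c c' : Curve X) :
    𝒳.curveProd c c' = 𝒳.curveProd c' c := by
  simp only [curveProd, Set.inter_comm c.dom, dist_comm (c.path _)]

/-- Up to the smaller of two times that almost realise the products, both pairs stay close by
convexity. The triangle inequality makes the outer curves close at that time, and
`exists_min_le_curveProd` turns this into a bound for their product. -/
theorem exists_min_curveProd_le (𝒳 : CoarselyConvexStructure X) :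
    ∃ K : ℝ≥0, ∀ c₁ c₂ c₃ : Curve X, 𝒳.IsGood c₁ → 𝒳.IsGood c₂ → 𝒳.IsGood c₃ →
      c₁.path 0 = c₂.path 0 → c₂.path 0 = c₃.path 0 →
        min (𝒳.curveProd c₁ c₂) (𝒳.curveProd c₂ c₃) ≤ K * 𝒳.curveProd c₁ c₃ := by
  set M := 𝒳.E * (2 * 𝒳.D + 2) + 𝒳.E * 0 + 𝒳.D
  obtain ⟨K, -, hK⟩ := 𝒳.exists_min_le_curveProd (M + M)
  refine ⟨K, fun c₁ c₂ c₃ h₁ h₂ h₃ h₁₂ h₂₃ => le_of_forall_lt fun x hx => ?_⟩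
  obtain ⟨t, ht₁, ht₂, ht, hxt⟩ := exists_of_lt_curveProd (hx.trans_le (min_le_left _ _))
  obtain ⟨s, hs₂, hs₃, hs, hxs⟩ := exists_of_lt_curveProd (hx.trans_le (min_le_right _ _))
  have d₁ := h₁.dist_le_of_le h₂ ht₁ ht₂ (min_le_left t s) (M₀ := 0) (by simp [h₁₂]) ht
  have d₂ := h₂.dist_le_of_le h₃ hs₂ hs₃ (min_le_right t s) (M₀ := 0) (by simp [h₂₃]) hs
  have := hK c₁ c₃ h₁ h₃ (h₁₂.trans h₂₃) _ (h₁.mem_of_le ht₁ (min_le_left t s)) _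
    (h₃.mem_of_le hs₃ (min_le_right t s)) ((dist_triangle _ _ _).trans (add_le_add d₁ d₂))
  rw [min_self] at this
  refine lt_of_lt_of_le ?_ this
  rw [ENNReal.coe_min]
  exact lt_min hxt hxs

/-! ### Representatives and the product on the bordification -/

variable {O : X}

theorem IsGood.of_mem_reps {p : Bordification 𝒳 O} {c : Curve X} (hc : c ∈ 𝒳.reps O p) :
    𝒳.IsGood c := by
  cases p with
  | pt x =>
    obtain ⟨γ, hγ, -, rfl⟩ := hc
    exact Or.inl ⟨γ, hγ.1, rfl⟩
  | bd ξ =>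
    obtain ⟨γ, -, rfl⟩ := hc
    exact Or.inr ⟨γ, γ.2.1, rfl⟩

theorem path_zero_of_mem_reps {p : Bordification 𝒳 O} {c : Curve X} (hc : c ∈ 𝒳.reps O p) :
    c.path 0 = O := by
  cases p with
  | pt x =>
    obtain ⟨γ, hγ, -, rfl⟩ := hc
    exact hγ.2.2
  | bd ξ =>
    obtain ⟨γ, -, rfl⟩ := hc
    exact γ.2.2

/-- A finite product `v` would be contradicted by closeness at time `K * v + 1`. -/
theorem curveProd_eq_top_of_dist_le {c c' : Curve X} (hc : 𝒳.IsGood c) (hc' : 𝒳.IsGood c')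
    (h₀ : c.path 0 = c'.path 0) (hd : c.dom = Set.univ) (hd' : c'.dom = Set.univ) {M : ℝ}
    (h : ∀ t, dist (c.path t) (c'.path t) ≤ M) : 𝒳.curveProd c c' = ⊤ := by
  obtain ⟨K, -, hK⟩ := 𝒳.exists_min_le_curveProd M
  by_contra hne
  lift 𝒳.curveProd c c' to ℝ≥0 using hne with v hv
  have := hK c c' hc hc' h₀ (K * v + 1) (by simp [hd]) (K * v + 1) (by simp [hd']) (h _)
  rw [min_self, ← hv] at this
  norm_cast at this
  exact absurd this (not_le.2 (lt_add_one _))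

/-- Two representatives of one point fellow-travel for essentially their whole length: segments to
the same point have lengths differing by at most `paramBound 0`, and equivalent rays have infinite
product. The bound `1 ≤ K` rules out `0 * ⊤` in the ray case and is needed again when
representatives are exchanged. -/
theorem exists_le_curveProd_of_mem_reps (𝒳 : CoarselyConvexStructure X) (O : X) :
    ∃ K L : ℝ≥0, 1 ≤ K ∧ ∀ p, ∀ γ ∈ 𝒳.reps O p, ∀ γ' ∈ 𝒳.reps O p, ∀ t ∈ γ.dom,
      (t : ℝ≥0∞) ≤ K * 𝒳.curveProd γ γ' + L := by
  obtain ⟨K, hK₁, hK⟩ := 𝒳.exists_min_le_curveProd 0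
  refine ⟨K, (𝒳.paramBound 0).toNNReal, hK₁, fun p γ hγ γ' hγ' t ht => ?_⟩
  have hg := IsGood.of_mem_reps hγ
  have hg' := IsGood.of_mem_reps hγ'
  have h₀ : γ.path 0 = γ'.path 0 :=
    (path_zero_of_mem_reps hγ).trans (path_zero_of_mem_reps hγ').symm
  cases p with
  | pt x =>
    obtain ⟨σ, -, hx, rfl⟩ := hγ
    obtain ⟨σ', -, hx', rfl⟩ := hγ'
    have hend : dist (σ.toCurve.path σ.len) (σ'.toCurve.path σ'.len) ≤ 0 := by
      simp [Segment.toCurve, hx, hx']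
    have hmem : σ.len ∈ σ.toCurve.dom := le_refl σ.len
    have hmem' : σ'.len ∈ σ'.toCurve.dom := le_refl σ'.len
    have hreg := hg.param_reg hg' hmem hmem' (M := 0) (by simpa [h₀] using hend)
    have hlen : t ≤ min σ.len σ'.len + (𝒳.paramBound 0).toNNReal := by
      refine le_trans (show t ≤ σ.len from ht) ?_
      rw [← NNReal.coe_le_coe]
      push_cast
      rw [Real.coe_toNNReal _ (𝒳.paramBound_nonneg 0)]
      have := (abs_le.1 hreg).2
      have := 𝒳.paramBound_nonneg 0
      rcases min_choice (σ.len : ℝ) σ'.len with h | h <;> rw [h] <;> linarith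
    calc (t : ℝ≥0∞) ≤ ((min σ.len σ'.len + (𝒳.paramBound 0).toNNReal : ℝ≥0) : ℝ≥0∞) := by
          exact_mod_cast hlen
      _ ≤ _ := by
          rw [ENNReal.coe_add]
          gcongr
          exact hK _ _ hg hg' h₀ _ hmem _ hmem' hend
  | bd ξ =>
    obtain ⟨ρ, hρ, rfl⟩ := hγ
    obtain ⟨ρ', hρ', rfl⟩ := hγ'
    obtain ⟨M, hM⟩ : RayEquiv (ρ : ℝ≥0 → X) (ρ' : ℝ≥0 → X) :=
      Quotient.exact (s := raySetoid (𝒳.raysAt O)) (hρ.trans hρ'.symm)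
    rw [curveProd_eq_top_of_dist_le hg hg' h₀ rfl rfl hM,
      ENNReal.mul_top (by simpa using (zero_lt_one.trans_le hK₁).ne')]
    simp

/-- Replacing a representative changes products in a controlled way. -/
theorem exists_curveProd_le_of_mem_reps (𝒳 : CoarselyConvexStructure X) (O : X) :
    ∃ K L : ℝ≥0, ∀ p, ∀ γ ∈ 𝒳.reps O p, ∀ γ' ∈ 𝒳.reps O p, ∀ η, 𝒳.IsGood η → η.path 0 = O →
      𝒳.curveProd γ η ≤ K * 𝒳.curveProd γ' η + L := by
  obtain ⟨K, L, hK₁, hK⟩ := 𝒳.exists_le_curveProd_of_mem_reps O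
  obtain ⟨K', hK'⟩ := 𝒳.exists_min_curveProd_le
  refine ⟨K * K', L, fun p γ hγ γ' hγ' η hη hη₀ => ?_⟩
  -- Every time counted in the product with `γ` lies in the domain of `γ`, where `γ'` follows `γ`;
  -- so this product is also bounded by that of `γ'` and `γ`, and the quasi-ultrametric inequality
  -- through `γ` applies.
  have h₁ : 𝒳.curveProd γ η ≤ K * 𝒳.curveProd γ' γ + L := by
    refine iSup₂_le fun t ht => ?_
    rw [curveProd_comm]
    exact hK p γ hγ γ' hγ' t ht.1.1
  have h₂ : 𝒳.curveProd γ η ≤ K * 𝒳.curveProd γ η + L :=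
    (le_mul_of_one_le_left zero_le (by exact_mod_cast hK₁)).trans le_self_add
  have h₃ := hK' γ' γ η (IsGood.of_mem_reps hγ') (IsGood.of_mem_reps hγ) hη
    ((path_zero_of_mem_reps hγ').trans (path_zero_of_mem_reps hγ).symm)
    ((path_zero_of_mem_reps hγ).trans hη₀.symm)
  have h₄ : 𝒳.curveProd γ η ≤ K * min (𝒳.curveProd γ' γ) (𝒳.curveProd γ η) + L := by
    rcases min_choice (𝒳.curveProd γ' γ) (𝒳.curveProd γ η) with h | h <;> rw [h] <;> assumption
  calc 𝒳.curveProd γ η ≤ K * (K' * 𝒳.curveProd γ' η) + L := h₄.trans (by gcongr)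
    _ = _ := by rw [ENNReal.coe_mul, mul_assoc]

theorem gromovProd_eq_zero {p q : Bordification 𝒳 O} (h : 𝒳.IsInner O p ∨ 𝒳.IsInner O q) :
    𝒳.gromovProd O p q = 0 := if_pos h

theorem gromovProd_comm (𝒳 : CoarselyConvexStructure X) (O : X) (p q : Bordification 𝒳 O) :
    𝒳.gromovProd O p q = 𝒳.gromovProd O q p := by
  have h : ⨆ γ ∈ 𝒳.reps O p, ⨆ η ∈ 𝒳.reps O q, 𝒳.curveProd γ η =
      ⨆ γ ∈ 𝒳.reps O q, ⨆ η ∈ 𝒳.reps O p, 𝒳.curveProd γ η := by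
    rw [iSup₂_comm]
    simp only [fun γ η => 𝒳.curveProd_comm γ η]
  unfold gromovProd
  split_ifs <;> first | rfl | exact h | tauto

theorem curveProd_le_gromovProd {p q : Bordification 𝒳 O} (hp : ¬ 𝒳.IsInner O p)
    (hq : ¬ 𝒳.IsInner O q) {γ η : Curve X} (hγ : γ ∈ 𝒳.reps O p) (hη : η ∈ 𝒳.reps O q) :
    𝒳.curveProd γ η ≤ 𝒳.gromovProd O p q := by
  rw [gromovProd, if_neg (not_or.2 ⟨hp, hq⟩)]
  exact (le_iSup₂ (f := fun η (_ : η ∈ 𝒳.reps O q) => 𝒳.curveProd γ η) η hη).trans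
    (le_iSup₂ (f := fun γ (_ : γ ∈ 𝒳.reps O p) => ⨆ η ∈ 𝒳.reps O q, 𝒳.curveProd γ η) γ hγ)

/-- Replacing the two representatives one after the other shows that any single pair computes the
supremum up to affine distortion. -/
theorem exists_gromovProd_le (𝒳 : CoarselyConvexStructure X) (O : X) :
    ∃ K L : ℝ≥0, ∀ p q, ∀ γ ∈ 𝒳.reps O p, ∀ η ∈ 𝒳.reps O q,
      𝒳.gromovProd O p q ≤ K * 𝒳.curveProd γ η + L := by
  obtain ⟨K, L, hK⟩ := 𝒳.exists_curveProd_le_of_mem_reps O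
  refine ⟨K * K, K * L + L, fun p q γ hγ η hη => ?_⟩
  unfold gromovProd
  split_ifs with h
  · exact zero_le
  · refine iSup₂_le fun γ' hγ' => iSup₂_le fun η' hη' => ?_
    have h₁ := hK p γ' hγ' γ hγ η' (IsGood.of_mem_reps hη') (path_zero_of_mem_reps hη')
    have h₂ := hK q η' hη' η hη γ (IsGood.of_mem_reps hγ) (path_zero_of_mem_reps hγ)
    rw [𝒳.curveProd_comm η', 𝒳.curveProd_comm η] at h₂
    calc 𝒳.curveProd γ' η' ≤ K * (K * 𝒳.curveProd γ η + L) + L := h₁.trans (by gcongr)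
      _ = _ := by
        push_cast
        ring

/-- Any segment from `O` to a point outside of the inner ball is long enough to represent it. -/
theorem two_theta_le_len {σ : Segment X} (hσ : σ ∈ 𝒳.segs) (h₀ : σ.path 0 = O)
    (h : ¬ 𝒳.IsInner O (.pt (σ.path σ.len))) : 2 * 𝒳.theta 0 ≤ σ.len := by
  have hq := (𝒳.quasiGeodesic σ hσ σ.len 0 le_rfl zero_le).2
  have h' : 2 * 𝒳.lam * 𝒳.theta 0 + 𝒳.k < dist (σ.path σ.len) O := not_le.1 h
  rw [h₀, NNReal.coe_zero, sub_zero, NNReal.abs_eq] at hq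
  rw [← NNReal.coe_le_coe]
  push_cast
  have : 𝒳.lam * (2 * (𝒳.theta 0 : ℝ)) < 𝒳.lam * σ.len := by linarith
  exact (lt_of_mul_lt_mul_left this 𝒳.lam_pos.le).le

theorem toCurve_mem_reps {σ : Segment X} (hσ : σ ∈ 𝒳.segs) (h₀ : σ.path 0 = O)
    (h : ¬ 𝒳.IsInner O (.pt (σ.path σ.len))) : σ.toCurve ∈ 𝒳.reps O (.pt (σ.path σ.len)) :=
  ⟨σ, ⟨hσ, two_theta_le_len hσ h₀ h, h₀⟩, rfl, rfl⟩

theorem ofRay_mem_reps (γ : 𝒳.raysAt O) :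
    Curve.ofRay γ.1 ∈ 𝒳.reps O (.bd (BoundaryAt.mk 𝒳 O γ)) :=
  ⟨γ, rfl, rfl⟩

theorem reps_nonempty {p : Bordification 𝒳 O} (hp : ¬ 𝒳.IsInner O p) :
    (𝒳.reps O p).Nonempty := by
  cases p with
  | pt x =>
    obtain ⟨σ, hσ, h₀, rfl⟩ := 𝒳.connect O x
    exact ⟨_, toCurve_mem_reps hσ h₀ hp⟩
  | bd ξ =>
    induction ξ using Quotient.inductionOn with
    | h γ => exact ⟨_, ofRay_mem_reps γ⟩

/-- The quasi-ultrametric inequality for the product on `X ∪ ∂_O X`. -/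
theorem exists_min_gromovProd_le (𝒳 : CoarselyConvexStructure X) (O : X) :
    ∃ K L : ℝ≥0, ∀ p q r : Bordification 𝒳 O,
      min (𝒳.gromovProd O p q) (𝒳.gromovProd O q r) ≤ K * 𝒳.gromovProd O p r + L := by
  obtain ⟨K, L, hK⟩ := 𝒳.exists_gromovProd_le O
  obtain ⟨K', hK'⟩ := 𝒳.exists_min_curveProd_le
  refine ⟨K * K', L, fun p q r => ?_⟩
  by_cases hp : 𝒳.IsInner O p
  · simp [gromovProd_eq_zero (q := q) (Or.inl hp)]
  by_cases hq : 𝒳.IsInner O q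
  · simp [gromovProd_eq_zero (p := p) (Or.inr hq)]
  by_cases hr : 𝒳.IsInner O r
  · simp [gromovProd_eq_zero (p := q) (Or.inr hr)]
  obtain ⟨γ, hγ⟩ := reps_nonempty hp
  obtain ⟨η, hη⟩ := reps_nonempty hq
  obtain ⟨ζ, hζ⟩ := reps_nonempty hr
  have h₃ := hK' γ η ζ (IsGood.of_mem_reps hγ) (IsGood.of_mem_reps hη) (IsGood.of_mem_reps hζ)
    ((path_zero_of_mem_reps hγ).trans (path_zero_of_mem_reps hη).symm)
    ((path_zero_of_mem_reps hη).trans (path_zero_of_mem_reps hζ).symm)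
  have h₁ := hK p q γ hγ η hη
  have h₂ := hK q r η hη ζ hζ
  have h₄ : min (𝒳.gromovProd O p q) (𝒳.gromovProd O q r) ≤
      K * min (𝒳.curveProd γ η) (𝒳.curveProd η ζ) + L := by
    rcases min_choice (𝒳.curveProd γ η) (𝒳.curveProd η ζ) with h | h <;> rw [h]
    exacts [(min_le_left _ _).trans h₁, (min_le_right _ _).trans h₂]
  calc min (𝒳.gromovProd O p q) (𝒳.gromovProd O q r)
      ≤ K * (K' * 𝒳.gromovProd O p r) + L := by
        refine h₄.trans ?_
        gcongr
        exact h₃.trans (by gcongr; exact curveProd_le_gromovProd hp hr hγ hζ)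
    _ = _ := by rw [ENNReal.coe_mul, mul_assoc]

theorem dist_le_of_len {σ : Segment X} (hσ : σ ∈ 𝒳.segs) :
    dist (σ.path σ.len) (σ.path 0) ≤ 𝒳.lam * σ.len + 𝒳.k := by
  simpa using (𝒳.quasiGeodesic σ hσ σ.len 0 le_rfl zero_le).2

theorem len_le_of_dist {σ : Segment X} (hσ : σ ∈ 𝒳.segs) :
    (σ.len : ℝ) ≤ 𝒳.lam * dist (σ.path σ.len) (σ.path 0) + 𝒳.lam * 𝒳.k := by
  have h := (𝒳.quasiGeodesic σ hσ σ.len 0 le_rfl zero_le).1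
  rw [NNReal.coe_zero, sub_zero, NNReal.abs_eq] at h
  have h₁ := mul_le_mul_of_nonneg_left h 𝒳.lam_pos.le
  rw [mul_sub, mul_inv_cancel_left₀ 𝒳.lam_pos.ne'] at h₁
  linarith

/-- Products with a point `x` are controlled by the distance of `x` to the base point. -/
theorem exists_gromovProd_pt_le (𝒳 : CoarselyConvexStructure X) (O : X) :
    ∃ K L : ℝ≥0, ∀ x q, 𝒳.gromovProd O (.pt x) q ≤ K * ENNReal.ofReal (dist x O) + L := by
  refine ⟨𝒳.lam.toNNReal, (𝒳.lam * 𝒳.k).toNNReal, fun x q => ?_⟩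
  unfold gromovProd
  split_ifs with h
  · exact zero_le
  · refine iSup₂_le fun γ hγ => iSup₂_le fun η _ => iSup₂_le fun t ht => ?_
    obtain ⟨σ, ⟨hσ, -, rfl⟩, rfl, rfl⟩ := hγ
    have htl : t ≤ σ.len := ht.1.1
    have hl := len_le_of_dist hσ
    have hlk : 0 ≤ 𝒳.lam * 𝒳.k := mul_nonneg 𝒳.lam_pos.le 𝒳.k_nonneg
    have hld := mul_nonneg 𝒳.lam_pos.le
      (dist_nonneg (x := σ.path σ.len) (y := σ.path 0))
    calc (t : ℝ≥0∞) ≤ (σ.len : ℝ≥0∞) := by exact_mod_cast htl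
      _ = ENNReal.ofReal σ.len := (ENNReal.ofReal_coe_nnreal).symm
      _ ≤ ENNReal.ofReal (𝒳.lam * dist (σ.path σ.len) (σ.path 0) + 𝒳.lam * 𝒳.k) :=
        ENNReal.ofReal_le_ofReal hl
      _ = _ := by
        rw [ENNReal.ofReal_add hld hlk, ENNReal.ofReal_mul 𝒳.lam_pos.le]
        rfl

/-- Close points far away from the base point have a large product. -/
theorem exists_dist_le_gromovProd (𝒳 : CoarselyConvexStructure X) (O : X) (M : ℝ) :
    ∃ K L : ℝ≥0, ∀ x y, dist x y ≤ M →
      ENNReal.ofReal (dist x O) ≤ K * 𝒳.gromovProd O (.pt x) (.pt y) + L := by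
  obtain ⟨K, -, hK⟩ := 𝒳.exists_min_le_curveProd M
  set I := 2 * 𝒳.lam * 𝒳.theta 0 + 𝒳.k with hI
  have hI₀ : 0 ≤ I := by
    have := 𝒳.lam_pos
    have := 𝒳.k_nonneg
    positivity
  have hlam := 𝒳.lam_pos
  have hB := 𝒳.paramBound_nonneg M
  have hN : 0 ≤ 𝒳.lam * 𝒳.paramBound M + I := by positivity
  refine ⟨𝒳.lam.toNNReal * K, (𝒳.lam * 𝒳.paramBound M + I + |M|).toNNReal, fun x y hxy => ?_⟩
  -- The product is zero when `x` or `y` is inner, but then `x` is within `I + |M|` of `O`, which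
  -- the additive constant absorbs.
  have hle : ∀ d ≤ 𝒳.lam * 𝒳.paramBound M + I + |M|, ENNReal.ofReal d ≤
      (𝒳.lam.toNNReal * K : ℝ≥0) * 𝒳.gromovProd O (.pt x) (.pt y) +
        (𝒳.lam * 𝒳.paramBound M + I + |M|).toNNReal := fun d hd =>
    (ENNReal.ofReal_le_ofReal hd).trans le_add_self
  have hM := le_abs_self M
  by_cases hx : 𝒳.IsInner O (.pt x)
  · have hx' : dist x O ≤ I := hx
    have := abs_nonneg M
    have := mul_nonneg hlam.le hB
    exact hle _ (by linarith)
  by_cases hy : 𝒳.IsInner O (.pt y)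
  · have hy' : dist y O ≤ I := hy
    have := dist_triangle x y O
    have := mul_nonneg hlam.le hB
    exact hle _ (by linarith)
  obtain ⟨σ, hσ, h₀, rfl⟩ := 𝒳.connect O x
  obtain ⟨σ', hσ', h₀', rfl⟩ := 𝒳.connect O y
  have hg : 𝒳.IsGood σ.toCurve := Or.inl ⟨σ, hσ, rfl⟩
  have hg' : 𝒳.IsGood σ'.toCurve := Or.inl ⟨σ', hσ', rfl⟩
  have hstart : σ.toCurve.path 0 = σ'.toCurve.path 0 := h₀.trans h₀'.symm
  have hmem : σ.len ∈ σ.toCurve.dom := le_refl σ.len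
  have hmem' : σ'.len ∈ σ'.toCurve.dom := le_refl σ'.len
  have hreg := hg.param_reg hg' hmem hmem' (M := M)
    (by rw [hstart, dist_self, zero_add]; exact hxy)
  have hprod := (hK _ _ hg hg' hstart _ hmem _ hmem' hxy).trans
    (mul_le_mul_right (curveProd_le_gromovProd hx hy (toCurve_mem_reps hσ h₀ hx)
      (toCurve_mem_reps hσ' h₀' hy)) (K : ℝ≥0∞))
  have hlen : (σ.len : ℝ) ≤ (min σ.len σ'.len : ℝ≥0) + 𝒳.paramBound M := by
    push_cast
    have := (abs_le.1 hreg).2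
    rcases min_choice (σ.len : ℝ) σ'.len with h | h <;> rw [h] <;> linarith
  have hdist := dist_le_of_len hσ
  rw [h₀] at hdist
  have hmul := mul_le_mul_of_nonneg_left hlen hlam.le
  have hkI : 𝒳.k ≤ I := by
    rw [hI]
    have : 0 ≤ 2 * 𝒳.lam * 𝒳.theta 0 := by positivity
    linarith
  calc ENNReal.ofReal (dist (σ.path σ.len) O)
      ≤ ENNReal.ofReal (𝒳.lam * (min σ.len σ'.len : ℝ≥0) +
          (𝒳.lam * 𝒳.paramBound M + I + |M|)) := by
        refine ENNReal.ofReal_le_ofReal ?_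
        have := abs_nonneg M
        linarith
    _ = 𝒳.lam.toNNReal * (min σ.len σ'.len : ℝ≥0) +
          (𝒳.lam * 𝒳.paramBound M + I + |M|).toNNReal := by
        rw [ENNReal.ofReal_add (by positivity) (by positivity), ENNReal.ofReal_mul hlam.le,
          ENNReal.ofReal_coe_nnreal]
        rfl
    _ ≤ 𝒳.lam.toNNReal * (K * 𝒳.gromovProd O (.pt (σ.path σ.len)) (.pt (σ'.path σ'.len))) +
          (𝒳.lam * 𝒳.paramBound M + I + |M|).toNNReal := by gcongr
    _ = _ := by rw [ENNReal.coe_mul, mul_assoc]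

end CoarselyConvexStructure

/-! ### Divergence of products -/

theorem tendsto_top_of_le_mul_add {ι : Type*} {l : Filter ι} {u v : ι → ℝ≥0∞} {K L : ℝ≥0}
    (h : ∀ᶠ i in l, u i ≤ K * v i + L) (hu : Filter.Tendsto u l (𝓝 ⊤)) :
    Filter.Tendsto v l (𝓝 ⊤) := by
  rw [ENNReal.tendsto_nhds_top_iff_nnreal] at hu ⊢
  intro x
  filter_upwards [h, hu (K * x + L)] with i h₁ h₂
  by_contra hle
  have : (K : ℝ≥0∞) * v i + L ≤ K * x + L := by
    gcongr
    exact not_lt.1 hle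
  exact absurd (h₂.trans_le (h₁.trans this)) (by simp)

namespace CoarselyConvexStructure

variable {𝒳 : CoarselyConvexStructure X} {O : X}

theorem tendsto_gromovProd_symm {ι : Type*} {l : Filter ι} {p q : ι → Bordification 𝒳 O}
    (h : Filter.Tendsto (fun i => 𝒳.gromovProd O (p i) (q i)) l (𝓝 ⊤)) :
    Filter.Tendsto (fun i => 𝒳.gromovProd O (q i) (p i)) l (𝓝 ⊤) := by
  simpa only [𝒳.gromovProd_comm O (p _)] using h

/-- The quasi-ultrametric inequality in the form in which all later arguments use it. -/
theorem tendsto_gromovProd_trans {ι : Type*} {l : Filter ι} {p q r : ι → Bordification 𝒳 O}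
    (h : Filter.Tendsto (fun i => 𝒳.gromovProd O (p i) (q i)) l (𝓝 ⊤))
    (h' : Filter.Tendsto (fun i => 𝒳.gromovProd O (q i) (r i)) l (𝓝 ⊤)) :
    Filter.Tendsto (fun i => 𝒳.gromovProd O (p i) (r i)) l (𝓝 ⊤) := by
  obtain ⟨K, L, hK⟩ := 𝒳.exists_min_gromovProd_le O
  refine tendsto_top_of_le_mul_add (Filter.Eventually.of_forall fun i => hK (p i) (q i) (r i)) ?_
  simpa using h.min h'

theorem tendsto_ofReal_dist_of_gromovProd {ι : Type*} {l : Filter ι} {x : ι → X}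
    {q : ι → Bordification 𝒳 O}
    (h : Filter.Tendsto (fun i => 𝒳.gromovProd O (.pt (x i)) (q i)) l (𝓝 ⊤)) :
    Filter.Tendsto (fun i => ENNReal.ofReal (dist (x i) O)) l (𝓝 ⊤) := by
  obtain ⟨K, L, hK⟩ := 𝒳.exists_gromovProd_pt_le O
  exact tendsto_top_of_le_mul_add (Filter.Eventually.of_forall fun i => hK (x i) (q i)) h

theorem tendsto_dist_of_gromovProd {ι : Type*} {l : Filter ι} {x : ι → X}
    {q : ι → Bordification 𝒳 O}
    (h : Filter.Tendsto (fun i => 𝒳.gromovProd O (.pt (x i)) (q i)) l (𝓝 ⊤)) :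
    Filter.Tendsto (fun i => dist (x i) O) l Filter.atTop :=
  ENNReal.tendsto_ofReal_nhds_top.1 (tendsto_ofReal_dist_of_gromovProd h)

theorem tendsto_gromovProd_of_dist_le {ι : Type*} {l : Filter ι} {x y : ι → X} {M : ℝ}
    (hx : Filter.Tendsto (fun i => dist (x i) O) l Filter.atTop)
    (h : ∀ i, dist (x i) (y i) ≤ M) :
    Filter.Tendsto (fun i => 𝒳.gromovProd O (.pt (x i)) (.pt (y i))) l (𝓝 ⊤) := by
  obtain ⟨K, L, hK⟩ := 𝒳.exists_dist_le_gromovProd O M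
  exact tendsto_top_of_le_mul_add (Filter.Eventually.of_forall fun i => hK (x i) (y i) (h i))
    (ENNReal.tendsto_ofReal_nhds_top.2 hx)

theorem not_isInner_bd (ξ : BoundaryAt 𝒳 O) : ¬ 𝒳.IsInner O (.bd ξ) := fun h => h

theorem gromovProd_bd_self (ξ : BoundaryAt 𝒳 O) : 𝒳.gromovProd O (.bd ξ) (.bd ξ) = ⊤ := by
  induction ξ using Quotient.inductionOn with
  | h γ =>
    have hγ := ofRay_mem_reps γ
    refine top_le_iff.1 (le_trans (le_of_eq ?_)
      (curveProd_le_gromovProd (not_isInner_bd _) (not_isInner_bd _) hγ hγ))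
    have hg := IsGood.of_mem_reps hγ
    exact (curveProd_eq_top_of_dist_le hg hg rfl rfl rfl (M := 0) (by simp)).symm

/-- An infinite product gives arbitrarily late times at which two representing rays are `2 D +
2`-close; convexity carries this back to all earlier times with a bound independent of the time. -/
theorem eq_of_gromovProd_bd_eq_top {ξ ζ : BoundaryAt 𝒳 O}
    (h : 𝒳.gromovProd O (.bd ξ) (.bd ζ) = ⊤) : ξ = ζ := by
  induction ξ using Quotient.inductionOn with
  | h γ =>
  induction ζ using Quotient.inductionOn with
  | h η =>
    obtain ⟨K, L, hK⟩ := 𝒳.exists_gromovProd_le O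
    have hγ := ofRay_mem_reps γ
    have hη := ofRay_mem_reps η
    have htop : 𝒳.curveProd (Curve.ofRay γ.1) (Curve.ofRay η.1) = ⊤ := by
      by_contra hne
      have := hK _ _ _ hγ _ hη
      rw [show 𝒳.gromovProd O (.bd (BoundaryAt.mk 𝒳 O γ)) (.bd (BoundaryAt.mk 𝒳 O η)) = ⊤ from h,
        top_le_iff] at this
      exact ENNReal.add_ne_top.2 ⟨ENNReal.mul_ne_top ENNReal.coe_ne_top hne,
        ENNReal.coe_ne_top⟩ this
    refine Quotient.sound (s := raySetoid (𝒳.raysAt O))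
      ⟨𝒳.E * (2 * 𝒳.D + 2) + 𝒳.E * 0 + 𝒳.D, fun u => ?_⟩
    obtain ⟨t, ht₁, ht₂, ht, hut⟩ :=
      exists_of_lt_curveProd (htop ▸ ENNReal.coe_lt_top : (u : ℝ≥0∞) < 𝒳.curveProd _ _)
    exact (IsGood.of_mem_reps hγ).dist_le_of_le (IsGood.of_mem_reps hη) ht₁ ht₂
      (by exact_mod_cast hut.le) (by simp [path_zero_of_mem_reps hγ, path_zero_of_mem_reps hη]) ht

/-! ### Entourages and convergence to boundary points -/

theorem mem_entourage_self (p : Bordification 𝒳 O) {n : ℕ} (hn : 1 ≤ n) :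
    (p, p) ∈ 𝒳.entourage O n := by
  cases p with
  | pt x =>
    refine Or.inr ⟨x, x, rfl, ?_⟩
    rw [dist_self]
    have : (0 : ℝ) < n := by exact_mod_cast hn
    positivity
  | bd ξ =>
    refine Or.inl ?_
    change (n : ℝ≥0∞) < 𝒳.gromovProd O (.bd ξ) (.bd ξ)
    rw [gromovProd_bd_self]
    exact ENNReal.natCast_lt_top n

/-- Two product conditions compose by the quasi-ultrametric inequality and two metric ones by the
triangle inequality. In the mixed case, a large product with `x` forces `x` far from `O`, so a point
`y` near `x` has large product with it, which reduces to the first case. -/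
theorem exists_entourage_comp (𝒳 : CoarselyConvexStructure X) (O : X) {n : ℕ} (hn : 1 ≤ n) :
    ∃ m : ℕ, 1 ≤ m ∧ ∀ p q r, (p, q) ∈ 𝒳.entourage O m → (q, r) ∈ 𝒳.entourage O m →
      (p, r) ∈ 𝒳.entourage O n := by
  obtain ⟨K, L, hK⟩ := 𝒳.exists_min_gromovProd_le O
  obtain ⟨K₁, L₁, hK₁⟩ := 𝒳.exists_gromovProd_pt_le O
  obtain ⟨K₂, L₂, hK₂⟩ := 𝒳.exists_dist_le_gromovProd O 1
  set T : ℝ≥0 := K * n + L with hT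
  -- `T` is the level at which two products force the third above `n`. The three lower bounds for
  -- `m` serve the metric, product and mixed cases; the constants `K₂`, `L₂` for distance `1` apply
  -- since `1 / m ≤ 1`.
  obtain ⟨m, hm⟩ := exists_nat_ge (max (max (2 * n : ℝ≥0) T) (K₁ * (K₂ * T + L₂) + L₁))
  have hm₁ : 2 * n ≤ m := by
    exact_mod_cast ((le_max_left _ _).trans (le_max_left _ _)).trans hm
  have hm₂ : (T : ℝ≥0∞) ≤ m := by
    exact_mod_cast ((le_max_right _ _).trans (le_max_left _ _)).trans hm
  have hm₃ : (K₁ * (K₂ * T + L₂) + L₁ : ℝ≥0∞) ≤ m := by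
    exact_mod_cast (le_max_right _ _).trans hm
  have htri : ∀ p q r, (T : ℝ≥0∞) < 𝒳.gromovProd O p q → (T : ℝ≥0∞) < 𝒳.gromovProd O q r →
      (n : ℝ≥0∞) < 𝒳.gromovProd O p r := by
    intro p q r h₁ h₂
    by_contra hle
    have h₃ : (K : ℝ≥0∞) * 𝒳.gromovProd O p r + L ≤ T := by
      rw [hT]
      push_cast
      gcongr
      exact not_lt.1 hle
    exact absurd ((lt_min h₁ h₂).trans_le ((hK p q r).trans h₃)) (lt_irrefl _)
  have hpt : ∀ x y q, dist x y < (m : ℝ)⁻¹ → (m : ℝ≥0∞) < 𝒳.gromovProd O (.pt x) q →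
      (T : ℝ≥0∞) < 𝒳.gromovProd O (.pt x) (.pt y) := by
    intro x y q hd h
    by_contra hle
    have hd' : dist x y ≤ 1 :=
      hd.le.trans (inv_le_one_of_one_le₀ (by exact_mod_cast (by omega : 1 ≤ m)))
    have h₁ : 𝒳.gromovProd O (.pt x) q ≤ K₁ * (K₂ * T + L₂) + L₁ := by
      refine (hK₁ x q).trans ?_
      gcongr
      refine (hK₂ x y hd').trans ?_
      gcongr
      exact not_lt.1 hle
    exact absurd (h.trans_le (h₁.trans hm₃)) (lt_irrefl _)
  refine ⟨m, by omega, ?_⟩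
  rintro p q r (h | ⟨x, y, hpq, hxy⟩) (h' | ⟨x', y', hqr, hxy'⟩)
  · exact Or.inl (htri p q r (hm₂.trans_lt h) (hm₂.trans_lt h'))
  · obtain ⟨rfl, rfl⟩ := Prod.mk.inj hqr
    refine Or.inl (htri _ _ _ (hm₂.trans_lt h) (hpt x' y' p hxy' ?_))
    rw [gromovProd_comm]
    exact h
  · obtain ⟨rfl, rfl⟩ := Prod.mk.inj hpq
    refine Or.inl (htri _ _ _ ?_ (hm₂.trans_lt h'))
    rw [gromovProd_comm]
    rw [dist_comm] at hxy
    exact hpt y x r hxy h'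
  · obtain ⟨rfl, rfl⟩ := Prod.mk.inj hpq
    obtain ⟨hyx, rfl⟩ := Prod.mk.inj hqr
    cases hyx
    refine Or.inr ⟨x, y', rfl, ?_⟩
    have hn' : (0 : ℝ) < n := by exact_mod_cast hn
    have hmn : (m : ℝ)⁻¹ ≤ (2 * n : ℝ)⁻¹ := by
      gcongr
      exact_mod_cast hm₁
    calc dist x y' ≤ dist x y + dist y y' := dist_triangle _ _ _
      _ < (2 * n : ℝ)⁻¹ + (2 * n : ℝ)⁻¹ := by linarith
      _ = (n : ℝ)⁻¹ := by
        field_simp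
        norm_num

theorem entourage_mem_nhds (p : Bordification 𝒳 O) {n : ℕ} (hn : 1 ≤ n) :
    {q | (p, q) ∈ 𝒳.entourage O n} ∈ 𝓝 p := by
  rw [mem_nhds_iff]
  -- The usual candidate for the interior of `V_n(p)`: the points having some `V_m`-ball inside it.
  -- Its openness is the composition property.
  refine ⟨{q | ∃ m : ℕ, 1 ≤ m ∧ ∀ r, (q, r) ∈ 𝒳.entourage O m → (p, r) ∈ 𝒳.entourage O n},
    ?_, ?_, ⟨n, hn, fun _ h => h⟩⟩
  · rintro q ⟨m, hm, h⟩
    exact h q (mem_entourage_self q hm)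
  · rintro q ⟨m, hm, h⟩
    obtain ⟨l, hl, hcomp⟩ := 𝒳.exists_entourage_comp O hm
    exact ⟨l, hl, fun r hqr => ⟨l, hl, fun s hrs => h s (hcomp q r s hqr hrs)⟩⟩

/-- Convergence to a boundary point is divergence of the products. -/
theorem tendsto_nhds_bd_iff {ι : Type*} {l : Filter ι} {p : ι → Bordification 𝒳 O}
    {ξ : BoundaryAt 𝒳 O} :
    Filter.Tendsto p l (𝓝 (.bd ξ)) ↔
      Filter.Tendsto (fun i => 𝒳.gromovProd O (p i) (.bd ξ)) l (𝓝 ⊤) := by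
  refine ⟨fun h => ENNReal.tendsto_nhds_top fun n => ?_, fun h => ?_⟩
  · filter_upwards [h (entourage_mem_nhds (.bd ξ) (Nat.le_add_left 1 n))] with i hi
    rw [gromovProd_comm]
    rcases hi with hi | ⟨x, y, hxy, -⟩
    · exact lt_of_le_of_lt (by exact_mod_cast Nat.le_succ n) hi
    · cases (Prod.mk.inj hxy).1
  · refine tendsto_nhds.2 fun U hU hξ => ?_
    obtain ⟨n, -, hn⟩ := hU _ hξ
    filter_upwards [ENNReal.tendsto_nhds_top_iff_nat.1 h n] with i hi
    refine hn _ (Or.inl ?_)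
    rw [gromovProd_comm] at hi
    exact hi

/-- By transitivity the constant product of the two limits tends to `⊤`, hence equals `⊤`. -/
theorem bd_limit_unique {ι : Type*} {l : Filter ι} [l.NeBot] {p : ι → Bordification 𝒳 O}
    {ξ ζ : BoundaryAt 𝒳 O}
    (h : Filter.Tendsto (fun i => 𝒳.gromovProd O (p i) (.bd ξ)) l (𝓝 ⊤))
    (h' : Filter.Tendsto (fun i => 𝒳.gromovProd O (p i) (.bd ζ)) l (𝓝 ⊤)) : ξ = ζ :=
  eq_of_gromovProd_bd_eq_top (tendsto_nhds_unique tendsto_const_nhds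
    (tendsto_gromovProd_trans (tendsto_gromovProd_symm h) h'))

/-! ### Compactness and rays from the base point -/

/-- Good segments starting at `O` with lengths tending to infinity subconverge to a ray. -/
theorem exists_subseq_tendsto_ray [ProperSpace X] {σ : ℕ → Segment X} (hσ : ∀ n, σ n ∈ 𝒳.segs)
    (h₀ : ∀ n, (σ n).path 0 = O)
    (hlen : Filter.Tendsto (fun n => (σ n).len) Filter.atTop Filter.atTop) :
    ∃ φ : ℕ → ℕ, StrictMono φ ∧ ∃ γ ∈ 𝒳.raysAt O, ∀ i : ℕ,
      Filter.Tendsto (fun n => (σ (φ n)).path (i : ℝ≥0)) Filter.atTop (𝓝 (γ (i : ℝ≥0))) := by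
  have hcomp : IsCompact (Set.univ.pi fun i : ℕ => Metric.closedBall O (𝒳.lam * i + 𝒳.k)) :=
    isCompact_univ_pi fun i => isCompact_closedBall _ _
  obtain ⟨g, -, φ, hφ, hg⟩ := hcomp.tendsto_subseq
    -- Truncating at `len` keeps the points in the compact product of balls, as values beyond the
    -- domain are uncontrolled; for each fixed `i` the truncation is eventually void.
    (x := fun n (i : ℕ) => (σ n).path (min (i : ℝ≥0) (σ n).len)) (by
      intro n i _
      rw [Metric.mem_closedBall, ← h₀ n]
      refine ((𝒳.quasiGeodesic _ (hσ n) _ 0 (min_le_right _ _) zero_le).2).trans ?_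
      rw [NNReal.coe_zero, sub_zero, NNReal.abs_eq]
      have := 𝒳.lam_pos
      gcongr
      exact_mod_cast min_le_left (i : ℝ≥0) (σ n).len)
  have hlim : ∀ i : ℕ, Filter.Tendsto (fun n => (σ (φ n)).path (i : ℝ≥0)) Filter.atTop
      (𝓝 (g i)) := fun i => by
    refine ((tendsto_pi_nhds.1 hg) i).congr' ?_
    filter_upwards [(hlen.comp hφ.tendsto_atTop).eventually_ge_atTop (i : ℝ≥0)] with n hn
    simp only [Function.comp_apply]
    rw [min_eq_left (show (i : ℝ≥0) ≤ (σ (φ n)).len from hn)]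
  have hg₀ : g 0 = O := by
    refine tendsto_nhds_unique (hlim 0) ?_
    simp [h₀]
  refine ⟨φ, hφ, fun t => g ⌊t⌋₊, ⟨⟨⟨fun n => σ (φ n), fun n => ⟨hσ _, ?_⟩,
    hlen.comp hφ.tendsto_atTop, fun i => ?_⟩, fun t => ?_⟩, ?_⟩, fun i => ?_⟩
  · simp [h₀, hg₀]
  · simpa using hlim i
  · simp
  · simp [hg₀]
  · simpa using hlim i

theorem tendsto_len_of_dist {σ : ℕ → Segment X} {x : ℕ → X} (hσ : ∀ n, σ n ∈ 𝒳.segs)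
    (h₀ : ∀ n, (σ n).path 0 = O) (hx : ∀ n, (σ n).path (σ n).len = x n)
    (h : Filter.Tendsto (fun n => dist (x n) O) Filter.atTop Filter.atTop) :
    Filter.Tendsto (fun n => (σ n).len) Filter.atTop Filter.atTop := by
  rw [← NNReal.tendsto_coe_atTop]
  have h₁ := Filter.tendsto_atTop_add_const_right _ (-𝒳.k) h
  have h₂ := h₁.const_mul_atTop (inv_pos.2 𝒳.lam_pos)
  refine Filter.tendsto_atTop_mono (fun n => ?_) h₂
  have hd := dist_le_of_len (hσ n)
  rw [h₀, hx] at hd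
  rw [inv_mul_le_iff₀ 𝒳.lam_pos]
  linarith

/-- Points tending to infinity subconverge to a boundary point. -/
theorem exists_subseq_tendsto_bd [ProperSpace X] {x : ℕ → X}
    (h : Filter.Tendsto (fun n => dist (x n) O) Filter.atTop Filter.atTop) :
    ∃ φ : ℕ → ℕ, StrictMono φ ∧ ∃ γ : 𝒳.raysAt O, Filter.Tendsto
      (fun n => 𝒳.gromovProd O (.pt (x (φ n))) (.bd (BoundaryAt.mk 𝒳 O γ))) Filter.atTop
        (𝓝 ⊤) := by
  choose σ hσ h₀ hx using fun n => 𝒳.connect O (x n)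
  have hlen := tendsto_len_of_dist hσ h₀ hx h
  obtain ⟨φ, hφ, γ, hγ, hlim⟩ := exists_subseq_tendsto_ray hσ h₀ hlen
  refine ⟨φ, hφ, ⟨γ, hγ⟩, ENNReal.tendsto_nhds_top fun m => ?_⟩
  -- Closeness at the single time `m + 1` suffices: it makes the product at least `m + 1`, hence
  -- strictly greater than `m`.
  filter_upwards [(hlen.comp hφ.tendsto_atTop).eventually_ge_atTop ((m + 1 : ℕ) : ℝ≥0),
    (h.comp hφ.tendsto_atTop).eventually_gt_atTop (2 * 𝒳.lam * 𝒳.theta 0 + 𝒳.k),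
    Metric.tendsto_nhds.1 (hlim (m + 1)) 1 one_pos] with n h₁ h₂ h₃
  have hx' : ¬ 𝒳.IsInner O (.pt (x (φ n))) := not_le.2 h₂
  rw [← hx] at hx' ⊢
  refine lt_of_lt_of_le ?_ (curveProd_le_gromovProd hx' (not_isInner_bd _)
    (toCurve_mem_reps (hσ _) (h₀ _) hx') (ofRay_mem_reps ⟨γ, hγ⟩))
  have hD := 𝒳.D_nonneg
  refine lt_of_lt_of_le (b := (((m + 1 : ℕ) : ℝ≥0) : ℝ≥0∞)) (by exact_mod_cast Nat.lt_succ_self m)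
    (le_iSup₂ (f := fun (t : ℝ≥0) (_ : t ∈ {t : ℝ≥0 | t ∈ (σ (φ n)).toCurve.dom ∩
      (Curve.ofRay γ).dom ∧ dist ((σ (φ n)).toCurve.path t) ((Curve.ofRay γ).path t) ≤
        2 * 𝒳.D + 2}) => (t : ℝ≥0∞)) ((m + 1 : ℕ) : ℝ≥0) ⟨⟨h₁, trivial⟩, ?_⟩)
  exact h₃.le.trans (by linarith)

theorem tendsto_dist_ray {γ : ℝ≥0 → X} (hγ : γ ∈ 𝒳.rays) (O : X) :
    Filter.Tendsto (fun n : ℕ => dist (γ (n : ℝ≥0)) O) Filter.atTop Filter.atTop := by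
  have h₁ := tendsto_natCast_atTop_atTop (R := ℝ).const_mul_atTop (inv_pos.2 𝒳.lam_pos)
  have h₂ := Filter.tendsto_atTop_add_const_right _ (-(𝒳.slack + dist O (γ 0))) h₁
  refine Filter.tendsto_atTop_mono (fun n => ?_) h₂
  have hg : 𝒳.IsGood (Curve.ofRay γ) := Or.inr ⟨γ, hγ, rfl⟩
  have hq : 𝒳.lam⁻¹ * |((n : ℝ≥0) : ℝ) - (0 : ℝ≥0)| - 𝒳.slack ≤ dist (γ n) (γ 0) :=
    (hg.quasiGeodesic (t := (n : ℝ≥0)) (s := 0) trivial trivial).1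
  rw [NNReal.coe_zero, sub_zero, NNReal.abs_eq, NNReal.coe_natCast] at hq
  have := dist_triangle (γ n) O (γ 0)
  linarith

/-- A ray converges to its class. -/
theorem tendsto_gromovProd_ray (γ : 𝒳.raysAt O) :
    Filter.Tendsto (fun n : ℕ => 𝒳.gromovProd O (.pt (γ.1 (n : ℝ≥0)))
      (.bd (BoundaryAt.mk 𝒳 O γ))) Filter.atTop (𝓝 ⊤) := by
  have h := tendsto_dist_ray γ.2.1 O
  choose σ hσ h₀ hx using fun n : ℕ => 𝒳.connect O (γ.1 (n : ℝ≥0))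
  have hlen := tendsto_len_of_dist hσ h₀ hx h
  obtain ⟨K, -, hK⟩ := 𝒳.exists_min_le_curveProd 0
  have hmin : Filter.Tendsto (fun n : ℕ => ((min (σ n).len n : ℝ≥0) : ℝ≥0∞)) Filter.atTop
      (𝓝 ⊤) := by
    rw [ENNReal.tendsto_coe_nhds_top]
    exact Filter.tendsto_inf_atTop _ hlen tendsto_natCast_atTop_atTop
  refine tendsto_top_of_le_mul_add (K := K) (L := 0) ?_ hmin
  filter_upwards [h.eventually_gt_atTop (2 * 𝒳.lam * 𝒳.theta 0 + 𝒳.k)] with n hn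
  have hx' : ¬ 𝒳.IsInner O (.pt (γ.1 (n : ℝ≥0))) := not_le.2 hn
  have hray := ofRay_mem_reps γ
  have hseg : (σ n).toCurve ∈ 𝒳.reps O (.pt (γ.1 (n : ℝ≥0))) := by
    rw [← hx] at hx' ⊢
    exact toCurve_mem_reps (hσ n) (h₀ n) hx'
  rw [ENNReal.coe_zero, add_zero]
  -- The segment at time `len` and the ray at time `n` are at the same point, so `M = 0` applies.
  refine (hK _ _ (IsGood.of_mem_reps hseg) (IsGood.of_mem_reps hray)
    ((path_zero_of_mem_reps hseg).trans (path_zero_of_mem_reps hray).symm)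
    (σ n).len (le_refl (σ n).len) n trivial ?_).trans ?_
  · simp [Segment.toCurve, Curve.ofRay, hx]
  · gcongr
    exact curveProd_le_gromovProd hx' (not_isInner_bd _) hseg hray

/-- In a proper space, every boundary point is represented by a ray from the base point. -/
theorem toBoundary_surjective [ProperSpace X] (𝒳 : CoarselyConvexStructure X) (O : X) :
    Function.Surjective (BoundaryAt.toBoundary : BoundaryAt 𝒳 O → Boundary 𝒳) := by
  intro z
  induction z using Quotient.inductionOn with
  | h η =>
    obtain ⟨η, hη⟩ := η
    choose σ hσ h₀ hx using fun n : ℕ => 𝒳.connect O (η (n : ℝ≥0))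
    have hlen := tendsto_len_of_dist hσ h₀ hx (tendsto_dist_ray hη O)
    obtain ⟨φ, hφ, γ, hγ, hlim⟩ := exists_subseq_tendsto_ray hσ h₀ hlen
    refine ⟨BoundaryAt.mk 𝒳 O ⟨γ, hγ⟩, Quotient.sound (s := raySetoid 𝒳.rays) ?_⟩
    have hη' : 𝒳.IsGood (Curve.ofRay η) := Or.inr ⟨η, hη, rfl⟩
    -- The segments start at `O` but end on `η`: `spread` bounds the distance at the smaller of the
    -- two end times, and convexity, now with initial distance `dist O (η 0)`, carries the bound
    -- back to time `i`.
    set M := 𝒳.E * 𝒳.spread (dist O (η 0)) 0 + 𝒳.E * dist O (η 0) + 𝒳.D with hM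
    have hclose : ∀ i : ℕ, dist (γ i) (η i) ≤ M := by
      intro i
      refine le_of_tendsto ((hlim i).dist tendsto_const_nhds) ?_
      filter_upwards [(hlen.comp hφ.tendsto_atTop).eventually_ge_atTop (i : ℝ≥0),
        Filter.eventually_ge_atTop i] with n hn hin
      have hin' : (i : ℝ≥0) ≤ (φ n : ℝ≥0) := by exact_mod_cast hin.trans (hφ.id_le n)
      have hg : 𝒳.IsGood (σ (φ n)).toCurve := Or.inl ⟨_, hσ _, rfl⟩
      have hmem : (σ (φ n)).len ∈ (σ (φ n)).toCurve.dom := le_refl (σ (φ n)).len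
      have hstart : dist ((σ (φ n)).toCurve.path 0) ((Curve.ofRay η).path 0) ≤ dist O (η 0) := by
        simp [Segment.toCurve, Curve.ofRay, h₀]
      have hend : dist ((σ (φ n)).toCurve.path (σ (φ n)).len) ((Curve.ofRay η).path (φ n)) ≤ 0 := by
        simp [Segment.toCurve, Curve.ofRay, hx]
      exact hg.dist_le_of_le hη' (hg.mem_of_le hmem (min_le_left _ _)) trivial (le_min hn hin')
        hstart (hg.dist_min_le hη' hmem trivial hstart hend)
    refine ⟨M, fun t => ?_⟩
    change dist (γ t) (η t) ≤ M
    rw [hγ.1.2 t, hη.2 t]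
    exact hclose _

end CoarselyConvexStructure

/-! ### Visual maps and boundary limits -/

variable {Y : Type*} [MetricSpace Y]

open CoarselyConvexStructure in
/-- The image of a ray under a visual map converges to a boundary point. -/
theorem IsVisual.exists_tendsto_bd [ProperSpace Y] {𝒳 : CoarselyConvexStructure X}
    {𝒴 : CoarselyConvexStructure Y} {a : X} {b : Y} {f : X → Y} (hf : IsVisual 𝒳 𝒴 a b f)
    (γ : 𝒳.raysAt a) :
    ∃ ζ : BoundaryAt 𝒴 b, Filter.Tendsto
      (fun n : ℕ => 𝒴.gromovProd b (.pt (f (γ.1 (n : ℝ≥0)))) (.bd ζ)) Filter.atTop (𝓝 ⊤) := by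
  have hγ := tendsto_gromovProd_ray γ
  -- Diverging products of the image points with themselves force these points to infinity.
  have hself := hf.2 _ _ (tendsto_gromovProd_trans hγ (tendsto_gromovProd_symm hγ))
  obtain ⟨φ, hφ, η, hη⟩ := exists_subseq_tendsto_bd (𝒳 := 𝒴) (tendsto_dist_of_gromovProd hself)
  -- Comparing the sequence with its own subsequence upgrades the subsequential limit to a full
  -- limit.
  have hsub := hf.2 (fun n : ℕ => γ.1 n) (fun n : ℕ => γ.1 (φ n)) (tendsto_gromovProd_trans hγ
    (tendsto_gromovProd_symm (hγ.comp hφ.tendsto_atTop)))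
  exact ⟨_, tendsto_gromovProd_trans hsub hη⟩

open CoarselyConvexStructure in
/-- A visual map sends sequences with the same boundary limit to sequences with the same
boundary limit. -/
theorem IsVisual.tendsto_bd_of_tendsto_bd {𝒳 : CoarselyConvexStructure X}
    {𝒴 : CoarselyConvexStructure Y} {a : X} {b : Y} {f : X → Y} (hf : IsVisual 𝒳 𝒴 a b f)
    {x x' : ℕ → X} {ξ : BoundaryAt 𝒳 a} {ζ : BoundaryAt 𝒴 b}
    (hx : Filter.Tendsto (fun n => 𝒳.gromovProd a (.pt (x n)) (.bd ξ)) Filter.atTop (𝓝 ⊤))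
    (hx' : Filter.Tendsto (fun n => 𝒳.gromovProd a (.pt (x' n)) (.bd ξ)) Filter.atTop (𝓝 ⊤))
    (h : Filter.Tendsto (fun n => 𝒴.gromovProd b (.pt (f (x n))) (.bd ζ)) Filter.atTop (𝓝 ⊤)) :
    Filter.Tendsto (fun n => 𝒴.gromovProd b (.pt (f (x' n))) (.bd ζ)) Filter.atTop (𝓝 ⊤) :=
  tendsto_gromovProd_trans
    (hf.2 _ _ (tendsto_gromovProd_trans hx' (tendsto_gromovProd_symm hx))) h

theorem BoundaryAt.toBoundary_injective {𝒳 : CoarselyConvexStructure X} {O : X} :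
    Function.Injective (BoundaryAt.toBoundary : BoundaryAt 𝒳 O → Boundary 𝒳) := by
  intro ξ ζ h
  induction ξ using Quotient.inductionOn with
  | h γ =>
  induction ζ using Quotient.inductionOn with
  | h η =>
    exact Quotient.sound (s := raySetoid (𝒳.raysAt O)) (Quotient.exact (s := raySetoid 𝒳.rays) h)

open CoarselyConvexStructure in
/-- Every boundary point of the target of a coarsely surjective visual map is the limit of the
image of a ray. -/
theorem IsVisual.exists_ray_tendsto_bd [ProperSpace X] {𝒳 : CoarselyConvexStructure X}
    {𝒴 : CoarselyConvexStructure Y} {a : X} {b : Y} {f : X → Y} (hf : IsVisual 𝒳 𝒴 a b f)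
    (hsurj : CoarselySurjective f) (ζ : BoundaryAt 𝒴 b) :
    ∃ γ : 𝒳.raysAt a, Filter.Tendsto
      (fun n : ℕ => 𝒴.gromovProd b (.pt (f (γ.1 (n : ℝ≥0)))) (.bd ζ)) Filter.atTop (𝓝 ⊤) := by
  induction ζ using Quotient.inductionOn with
  | h η =>
    obtain ⟨R, -, hR⟩ := hsurj
    choose x hx using fun n : ℕ => hR (η.1 (n : ℝ≥0))
    have hdist : Filter.Tendsto (fun n => dist (x n) a) Filter.atTop Filter.atTop := by
      -- The images stay within `R` of a ray going to infinity, and a large scale Lipschitz map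
      -- cannot send bounded sets to unbounded ones.
      obtain ⟨A, B, hA, -, hAB⟩ := hf.1
      have hA₀ : 0 < A := zero_lt_one.trans_le hA
      have h := Filter.tendsto_atTop_add_const_right _ (-(R + B)) (tendsto_dist_ray η.2.1 (f a))
      refine Filter.tendsto_atTop_mono (fun n => ?_) (h.const_mul_atTop (inv_pos.2 hA₀))
      rw [inv_mul_le_iff₀ hA₀]
      have := dist_triangle (η.1 (n : ℝ≥0)) (f (x n)) (f a)
      linarith [hx n, hAB (x n) a]
    obtain ⟨φ, hφ, γ, hγ⟩ := exists_subseq_tendsto_bd (𝒳 := 𝒳) hdist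
    have hη := tendsto_gromovProd_ray η
    have hfx : Filter.Tendsto (fun n => 𝒴.gromovProd b (.pt (f (x n)))
        (.bd (BoundaryAt.mk 𝒴 b η))) Filter.atTop (𝓝 ⊤) :=
      tendsto_gromovProd_trans (tendsto_gromovProd_symm
        (tendsto_gromovProd_of_dist_le (tendsto_dist_ray η.2.1 b) hx)) hη
    -- The sequences `x (φ n)` and `γ n` share a boundary limit, so their images do too.
    exact ⟨γ, hf.tendsto_bd_of_tendsto_bd hγ (tendsto_gromovProd_ray γ)
      (hfx.comp hφ.tendsto_atTop)⟩

end CoarseConvex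

/-! ### The induced map -/

open CoarseConvex CoarselyConvexStructure in
theorem proposition4p1 {X Y : Type*} [MetricSpace X] [ProperSpace X] [MetricSpace Y]
    [ProperSpace Y] (𝒳 : CoarseConvex.CoarselyConvexStructure X)
    (𝒴 : CoarseConvex.CoarselyConvexStructure Y) (a : X) (b : Y) (f : X → Y)
    (hvis : CoarseConvex.IsVisual 𝒳 𝒴 a b f) (hsurj : CoarseConvex.CoarselySurjective f) :
    (∃! F : CoarseConvex.Boundary 𝒳 → CoarseConvex.Boundary 𝒴,
      CoarseConvex.IsInducedBoundaryMap 𝒳 𝒴 a b f F) ∧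
    ∀ F : CoarseConvex.Boundary 𝒳 → CoarseConvex.Boundary 𝒴,
      CoarseConvex.IsInducedBoundaryMap 𝒳 𝒴 a b f F → Function.Surjective F := by
  have hray : ∀ x : Boundary 𝒳, ∃ γ : 𝒳.raysAt a, (BoundaryAt.mk 𝒳 a γ).toBoundary = x := by
    intro x
    obtain ⟨ξ, rfl⟩ := toBoundary_surjective 𝒳 a x
    induction ξ using Quotient.inductionOn with
    | h γ => exact ⟨γ, rfl⟩
  refine ⟨?_, fun F hF z => ?_⟩
  · choose ρ hρ using hray
    choose ζ hζ using hvis.exists_tendsto_bd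
    refine ⟨fun x => (ζ (ρ x)).toBoundary, fun x γ hγ => ⟨ζ (ρ x), ?_, rfl⟩, fun F hF => ?_⟩
    -- The limit along the chosen ray `ρ x` is also the limit along any other representative `γ`,
    -- since both rays converge to the same point of `∂_a X`.
    · have heq : BoundaryAt.mk 𝒳 a (ρ x) = BoundaryAt.mk 𝒳 a γ :=
        BoundaryAt.toBoundary_injective ((hρ x).trans hγ.symm)
      exact tendsto_nhds_bd_iff.2 (hvis.tendsto_bd_of_tendsto_bd
        (heq ▸ tendsto_gromovProd_ray (ρ x)) (tendsto_gromovProd_ray γ) (hζ (ρ x)))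
    · funext x
      obtain ⟨y, hy, hyF⟩ := hF x (ρ x) (hρ x)
      rw [← hyF, bd_limit_unique (tendsto_nhds_bd_iff.1 hy) (hζ (ρ x))]
  · obtain ⟨ζ, rfl⟩ := toBoundary_surjective 𝒴 b z
    obtain ⟨γ, hγ⟩ := hvis.exists_ray_tendsto_bd hsurj ζ
    obtain ⟨y, hy, hyF⟩ := hF _ γ rfl
    exact ⟨_, by rw [← hyF, bd_limit_unique (tendsto_nhds_bd_iff.1 hy) hγ]⟩
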